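/- All rings are commutative and Noetherian. Let $(R,\mathfrak m,k)$ be a Cohen-Macaulay local ring of Krull dimension $d$ with minimal multiplicity, i.e. $e(R)=\mu(\mathfrak m)-d+1$, where $\mu(\mathfrak m)$ is the minimal number of generators of $\mathfrak m$, and $e(R)$ is the multiplicity of $R$, i.e. $d!$ times the leading coefficient of the Hilbert-Samuel polynomial $P$ of $R$ (the polynomial of degree $d$ with $P(n)=\operatorname{length}_R(R/\mathfrak m^{n+1})$ for all $n\gg 0$). For $n\ge 0$ let $\Omega_n^R(k)$ denote the $n$th syzygy module of $k$, i.e. the image of the $n$th differential of an augmented minimal free resolution of $k$ (so $\Omega_0^R(k)=k$). Let $L$ be a non-zero maximal Cohen-Macaulay $R$-module (i.e. finitely generated with $\operatorname{depth} L=d$) that is a homomorphic image of a finite direct sum of modules of the form $\Omega_n^R(k)$, $n\ge 0$ (repetitions allowed). Then the following statements are equivalent: (i) $\operatorname{Ext}_R^i(L,R)=0$ for some $d+1$ consecutive values of $i\ge 1$, i.e. there is $s\ge 1$ with $\operatorname{Ext}_R^i(L,R)=0$ for all $s\le i\le s+d$; (ii) $\operatorname{Ext}_R^i(L,R)=0$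 for all $i\ge 1$; (iii) $R$ is Gorenstein, i.e. $R$ has finite injective dimension as an $R$-module. -/

import Mathlib

universe u

namespace LocalAlgebra

open IsLocalRing

section Depth

variable (R : Type u) [CommRing R] [IsLocalRing R]

/-- The depth of a module over a local ring: the supremum of the lengths of the regular sequences
on the module that consist of elements of the maximal ideal. -/
noncomputable def depth (M : Type u) [AddCommGroup M] [Module R M] : ℕ∞ :=
  ⨆ (rs : List R) (_ : RingTheory.Sequence.IsRegular M rs ∧ ∀ r ∈ rs, r ∈ maximalIdeal R),
    (rs.length : ℕ∞)

/-- A (Noetherian) local ring is Cohen-Macaulay if its depth equals its Krull dimension. -/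
def IsCohenMacaulay : Prop :=
  ((depth R R : ℕ∞) : WithBot ℕ∞) = ringKrullDim R

/-- A finitely generated module is maximal Cohen-Macaulay if its depth equals the Krull dimension
of the ring. (Used below only for non-zero modules.) -/
structure IsMaximalCohenMacaulay (M : Type u) [AddCommGroup M] [Module R M] : Prop where
  finite : Module.Finite R M
  depth_eq : ((depth R M : ℕ∞) : WithBot ℕ∞) = ringKrullDim R

/-- A (Noetherian) local ring is Gorenstein if it has finite injective dimension as a module over
itself. -/
def IsGorenstein : Prop :=
  ∃ n : ℕ, CategoryTheory.HasInjectiveDimensionLE (ModuleCat.of R R) n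

end Depth

section Multiplicity

variable (R : Type u) [CommRing R] [IsLocalRing R]

/-- `P` is the Hilbert-Samuel polynomial of `R`: `P n` is the length of `R ⧸ 𝔪 ^ (n + 1)` for all
large `n`. (These lengths are finite when `R` is Noetherian, and `P` is determined by them.) -/
def IsHilbertSamuelPolynomial (P : Polynomial ℚ) : Prop :=
  ∀ᶠ n : ℕ in Filter.atTop,
    ((Module.length R (R ⧸ maximalIdeal R ^ (n + 1))).toNat : ℚ) = P.eval (n : ℚ)

/-- `e` is the multiplicity of `R`: the normalized leading coefficient of its Hilbert-Samuel
polynomial `P`, that is, `P n = (e / δ!) * n ^ δ + (terms of lower degree)` where `δ` is the degree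
of `P` (which is the dimension of `R` when `R` is Noetherian). -/
def IsMultiplicity (e : ℕ) : Prop :=
  ∃ P : Polynomial ℚ, IsHilbertSamuelPolynomial R P ∧
    (e : ℚ) = (P.natDegree.factorial : ℚ) * P.leadingCoeff

/-- `R` has minimal multiplicity: `e(R) = μ(𝔪) - dim R + 1`. -/
def HasMinimalMultiplicity : Prop :=
  ∃ e d : ℕ, IsMultiplicity R e ∧ ringKrullDim R = d ∧
    (e : ℤ) = ((maximalIdeal R).spanFinrank : ℤ) - (d : ℤ) + 1

end Multiplicity

section Syzygy

/-- An (augmented) minimal free resolution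
`⋯ ⟶ R ^ rank 2 ⟶ R ^ rank 1 ⟶ R ^ rank 0 ⟶ M ⟶ 0` of a finitely generated module `M` over a
(Noetherian) local ring `R`. -/
structure MinimalFreeResolution (R : Type u) [CommRing R] [IsLocalRing R]
    (M : Type u) [AddCommGroup M] [Module R M] where
  rank : ℕ → ℕ
  aug : (Fin (rank 0) → R) →ₗ[R] M
  diff : ∀ n : ℕ, (Fin (rank (n + 1)) → R) →ₗ[R] (Fin (rank n) → R)
  aug_surjective : Function.Surjective aug
  exact_aug : Function.Exact (diff 0) aug
  exact_diff : ∀ n : ℕ, Function.Exact (diff (n + 1)) (diff n)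
  minimal : ∀ n : ℕ, LinearMap.range (diff n) ≤
    maximalIdeal R • (⊤ : Submodule R (Fin (rank n) → R))

/-- The `n`-th syzygy module of `M`: the image of the `n`-th differential of the augmented minimal
free resolution, the `0`-th differential being the augmentation. -/
noncomputable def MinimalFreeResolution.syzygy {R : Type u} [CommRing R] [IsLocalRing R]
    {M : Type u} [AddCommGroup M] [Module R M] (F : MinimalFreeResolution R M) :
    ℕ → ModuleCat.{u} R
  | 0 => ModuleCat.of R (LinearMap.range F.aug)
  | n + 1 => ModuleCat.of R (LinearMap.range (F.diff n))

end Syzygy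

section Existence

variable {R : Type u} [CommRing R] [IsLocalRing R]

/-- Every finitely generated module over a local ring has a minimal free cover. -/
theorem exists_minimal_cover (M : Type u) [AddCommGroup M] [Module R M] [Module.Finite R M] :
    ∃ (n : ℕ) (p : (Fin n → R) →ₗ[R] M), Function.Surjective p ∧
      LinearMap.ker p ≤ maximalIdeal R • (⊤ : Submodule R (Fin n → R)) := by
  classical
  have hex : ∃ (n : ℕ), ∃ (p : (Fin n → R) →ₗ[R] M), Function.Surjective p := by
    obtain ⟨n, p, hp⟩ := Module.Finite.exists_fin' R M
    exact ⟨n, p, hp⟩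
  obtain ⟨p, hp⟩ := Nat.find_spec hex
  have hmin : ∀ m < Nat.find hex, ¬ ∃ (p : (Fin m → R) →ₗ[R] M), Function.Surjective p :=
    fun m hm => Nat.find_min hex hm
  generalize Nat.find hex = n at p hp hmin
  refine ⟨n, p, hp, fun x hx => ?_⟩
  have hcoord : ∀ i, x i ∈ maximalIdeal R := by
    intro i
    by_contra hi
    have hu : IsUnit (x i) := by
      simpa [IsLocalRing.mem_maximalIdeal, mem_nonunits_iff] using hi
    obtain _ | k := n
    · exact i.elim0
    apply hmin k (Nat.lt_succ_self k)
    refine ⟨Fintype.linearCombination R (fun j => p (Pi.single (i.succAbove j) 1)), ?_⟩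
    rw [← LinearMap.range_eq_top, Fintype.range_linearCombination, eq_top_iff,
      ← LinearMap.range_eq_top.2 hp]
    rintro _ ⟨y, rfl⟩
    have hexp : ∀ z : Fin (k + 1) → R, p z = z i • p (Pi.single i 1)
        + ∑ j, z (i.succAbove j) • p (Pi.single (i.succAbove j) 1) := by
      intro z
      conv_lhs => rw [pi_eq_sum_univ' z]
      rw [map_sum, Fin.sum_univ_succAbove _ i]
      simp only [map_smul]
    have hs : ∀ z : Fin (k + 1) → R,
        ∑ j, z (i.succAbove j) • p (Pi.single (i.succAbove j) 1) ∈
          Submodule.span R (Set.range fun j => p (Pi.single (i.succAbove j) 1)) := fun z =>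
      Submodule.sum_mem _ fun j _ => Submodule.smul_mem _ _ (Submodule.subset_span ⟨j, rfl⟩)
    rw [hexp y]
    refine Submodule.add_mem _ (Submodule.smul_mem _ _ ?_) (hs y)
    have h0 := hexp x
    rw [LinearMap.mem_ker.1 hx] at h0
    rw [← Submodule.smul_mem_iff_of_isUnit _ hu, eq_neg_of_add_eq_zero_left h0.symm]
    exact Submodule.neg_mem _ (hs x)
  rw [pi_eq_sum_univ' x]
  exact Submodule.sum_mem _ fun i _ => Submodule.smul_mem_smul (hcoord i) trivial

/-- Every finitely generated module over a Noetherian local ring has a minimal free resolution. -/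
theorem nonempty_minimalFreeResolution [IsNoetherianRing R]
    (M : Type u) [AddCommGroup M] [Module R M] [Module.Finite R M] :
    Nonempty (MinimalFreeResolution R M) := by
  obtain ⟨n₀, aug, haug, hk⟩ := exists_minimal_cover (R := R) M
  have step : ∀ (a : ℕ) (K : Submodule R (Fin a → R)), ∃ (n : ℕ)
      (q : (Fin n → R) →ₗ[R] (Fin a → R)), LinearMap.range q = K ∧ LinearMap.ker q ≤ maximalIdeal R • ⊤ := by
    intro a K
    obtain ⟨n, q, hq, hqk⟩ := exists_minimal_cover (R := R) K
    refine ⟨n, K.subtype ∘ₗ q, ?_, ?_⟩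
    · rw [LinearMap.range_comp, LinearMap.range_eq_top.2 hq, Submodule.map_top,
        Submodule.range_subtype]
    · rw [LinearMap.ker_comp_of_ker_eq_bot _ K.ker_subtype]
      exact hqk
  choose len q hq hqk using step
  let st : ℕ → Σ a : ℕ, Submodule R (Fin a → R) := fun n =>
    Nat.rec ⟨n₀, LinearMap.ker aug⟩ (fun _ s => ⟨len s.1 s.2, LinearMap.ker (q s.1 s.2)⟩) n
  have hmin : ∀ n, (st n).2 ≤ maximalIdeal R • ⊤
    | 0 => hk
    | n + 1 => hqk _ _
  exact ⟨{
    rank := fun n => (st n).1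
    aug := aug
    diff := fun n => q (st n).1 (st n).2
    aug_surjective := haug
    exact_aug := LinearMap.exact_iff.2 (hq _ _).symm
    exact_diff := fun n => LinearMap.exact_iff.2 (hq _ _).symm
    minimal := fun n => (hq _ _).le.trans (hmin n) }⟩

end Existence

end LocalAlgebra

/-!
After passing to `S = R[X]` localized at `𝔪R[X]`, the residue field is infinite, so there is a
sequence `xs` of `d` general elements of the maximal ideal which is regular on `R` and on `L` and
for which `length (R / xs)` is the multiplicity. Minimal multiplicity and a count of lengths then
force `xs` to be part of a minimal generating system of `𝔪` with `𝔪² = xs 𝔪`. By induction along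
the resolution, `𝔪 Ω = xs Ω` for every syzygy `Ω` of `k`, hence `𝔪 L = xs L`, and `L / xs L` is a
nonzero `k`-vector space.

Let `N` be a finitely generated module, for instance `R`. If `Extⁱ(L, N)` vanishes for `d + 1`
consecutive values of `i ≥ 1`, cutting `L` down by `xs` gives `Extʲ(k, N) = 0` for one `j > d`. As `Extʲ(R / xs, N) = 0` for all `j > d`, and the kernel of
`R / xs → k` is again a `k`-vector space, this vanishing spreads to all `j > d`, so `N` has finite
injective dimension. Conversely, if `N` has finite injective dimension, then `Extʲ(k, N) = 0` for
`j > d`; so `Extʲ(L / ys L, N) = 0` for `j > d` and a maximal regular sequence `ys` on `L`, and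
Nakayama's lemma lifts this to `Extⁱ(L, N) = 0` for `i ≥ 1`.
-/

namespace LocalAlgebra

open CategoryTheory Abelian IsLocalRing
open scoped Pointwise TensorProduct

/-! ### Vanishing of Ext -/

section ExtVanishes

variable {R : Type u} [CommRing R]

/-- The vanishing of the module `Extⁱ(M, N)`. -/
def ExtVanishes (R : Type u) [CommRing R] (M N : Type u) [AddCommGroup M] [Module R M]
    [AddCommGroup N] [Module R N] (i : ℕ) : Prop :=
  Subsingleton (Ext (ModuleCat.of R M) (ModuleCat.of R N) i)

variable {A B C N : Type u} [AddCommGroup A] [Module R A] [AddCommGroup B] [Module R B]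
  [AddCommGroup C] [Module R C] [AddCommGroup N] [Module R N] {i : ℕ}

theorem ExtVanishes.eq_zero (h : ExtVanishes R A N i)
    (x : Ext (ModuleCat.of R A) (ModuleCat.of R N) i) : x = 0 :=
  Subsingleton.elim (h := h) _ _

theorem ExtVanishes.of_retract (h : ExtVanishes R B N i) (f : A →ₗ[R] B) (g : B →ₗ[R] A)
    (hgf : g ∘ₗ f = LinearMap.id) : ExtVanishes R A N i := by
  have hid : ModuleCat.ofHom f ≫ ModuleCat.ofHom g = 𝟙 (ModuleCat.of R A) := by
    rw [← ModuleCat.ofHom_comp, hgf]; rfl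
  refine subsingleton_of_forall_eq 0 fun x => ?_
  rw [← x.mk₀_id_comp, ← hid, ← Ext.mk₀_comp_mk₀_assoc,
    h.eq_zero ((Ext.mk₀ (ModuleCat.ofHom g)).comp x (zero_add i)), Ext.comp_zero]

theorem ExtVanishes.of_linearEquiv (h : ExtVanishes R B N i) (e : A ≃ₗ[R] B) :
    ExtVanishes R A N i :=
  h.of_retract e.toLinearMap e.symm.toLinearMap (by ext; simp)

theorem extVanishes_of_projective [Module.Projective R A] (i : ℕ) : ExtVanishes R A N (i + 1) :=
  Ext.subsingleton_of_projective _ _ i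

theorem extVanishes_of_subsingleton [Subsingleton A] (i : ℕ) : ExtVanishes R A N i := by
  have hid : 𝟙 (ModuleCat.of R A) = 0 := by ext a; exact Subsingleton.elim _ _
  refine subsingleton_of_forall_eq 0 fun x => ?_
  rw [← x.mk₀_id_comp, hid, Ext.mk₀_zero, Ext.zero_comp]

theorem shortExact_of_exact {f : A →ₗ[R] B} {g : B →ₗ[R] C} (hf : Function.Injective f)
    (hfg : Function.Exact f g) (hg : Function.Surjective g) :
    (ModuleCat.shortComplexOfCompEqZero f g hfg.linearMap_comp_eq_zero).ShortExact :=
  ModuleCat.shortComplex_shortExact _ hfg hf hg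

variable {f : A →ₗ[R] B} {g : B →ₗ[R] C} (hf : Function.Injective f)
  (hfg : Function.Exact f g) (hg : Function.Surjective g)

include hf hfg hg

theorem ExtVanishes.middle (hA : ExtVanishes R A N i) (hC : ExtVanishes R C N i) :
    ExtVanishes R B N i := by
  refine subsingleton_of_forall_eq 0 fun x => ?_
  obtain ⟨y, rfl⟩ := Ext.contravariant_sequence_exact₂ (shortExact_of_exact hf hfg hg) _ x
    (hA.eq_zero _)
  rw [hC.eq_zero y, Ext.comp_zero]

theorem ExtVanishes.right (hA : ExtVanishes R A N i) (hB : ExtVanishes R B N (i + 1)) :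
    ExtVanishes R C N (i + 1) := by
  refine subsingleton_of_forall_eq 0 fun x => ?_
  obtain ⟨y, rfl⟩ := Ext.contravariant_sequence_exact₃ (shortExact_of_exact hf hfg hg) _ x
    (hB.eq_zero _) (add_comm 1 i)
  rw [hA.eq_zero y, Ext.comp_zero]

theorem ExtVanishes.left (hB : ExtVanishes R B N i) (hC : ExtVanishes R C N (i + 1)) :
    ExtVanishes R A N i := by
  refine subsingleton_of_forall_eq 0 fun x => ?_
  obtain ⟨y, rfl⟩ := Ext.contravariant_sequence_exact₁ (shortExact_of_exact hf hfg hg) _ x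
    (add_comm 1 i) (hC.eq_zero _)
  rw [hB.eq_zero y, Ext.comp_zero]

theorem extVanishes_succ_iff [Module.Projective R B] :
    ExtVanishes R C N (i + 2) ↔ ExtVanishes R A N (i + 1) :=
  ⟨fun h => .left hf hfg hg (extVanishes_of_projective i) h,
    fun h => .right hf hfg hg h (extVanishes_of_projective (i + 1))⟩

theorem ExtVanishes.surjective_lcomp (h : ExtVanishes R C N 1) :
    Function.Surjective (LinearMap.lcomp R N f) := by
  intro φ
  obtain ⟨y, hy⟩ := Ext.contravariant_sequence_exact₁ (shortExact_of_exact hf hfg hg) _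
    (Ext.mk₀ (ModuleCat.ofHom φ)) (add_comm 1 0) (h.eq_zero _)
  obtain ⟨ψ, rfl⟩ := Ext.homEquiv₀.symm.surjective y
  have hψ : ModuleCat.ofHom f ≫ ψ = ModuleCat.ofHom φ :=
    Ext.homEquiv₀.symm.injective (by simpa using hy)
  exact ⟨ψ.hom, congrArg ModuleCat.Hom.hom hψ⟩

theorem extVanishes_one_iff [Module.Projective R B] :
    ExtVanishes R C N 1 ↔ Function.Surjective (LinearMap.lcomp R N f) := by
  refine ⟨fun h => h.surjective_lcomp hf hfg hg, fun h => subsingleton_of_forall_eq 0 fun x => ?_⟩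
  obtain ⟨y, rfl⟩ := Ext.contravariant_sequence_exact₃ (shortExact_of_exact hf hfg hg) _ x
    ((extVanishes_of_projective 0).eq_zero _) (add_comm 1 0)
  obtain ⟨φ, rfl⟩ := Ext.homEquiv₀.symm.surjective y
  obtain ⟨ψ, hψ⟩ := h φ.hom
  have hφ : φ = (ModuleCat.shortComplexOfCompEqZero f g hfg.linearMap_comp_eq_zero).f ≫
      ModuleCat.ofHom ψ := by
    ext1
    exact hψ.symm
  rw [hφ, Ext.homEquiv₀_symm_apply, ← Ext.mk₀_comp_mk₀]
  exact ShortComplex.ShortExact.extClass_comp_assoc _ _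

end ExtVanishes

section RegularSequences

variable {R : Type u} [CommRing R] {M N : Type u} [AddCommGroup M] [Module R M] [AddCommGroup N]
  [Module R N] {i : ℕ}

theorem ExtVanishes.quotSMulTop {x : R} (hx : IsSMulRegular M x) (h₀ : ExtVanishes R M N i)
    (h₁ : ExtVanishes R M N (i + 1)) : ExtVanishes R (QuotSMulTop x M) N (i + 1) :=
  .right (f := LinearMap.lsmul R M x) hx (LinearMap.exact_lsmul_mkQ_smul_top M x)
    (Submodule.mkQ_surjective _) h₀ h₁

theorem ExtVanishes.quotSMulTop_right {x : R} (hx : IsSMulRegular N x) (h₀ : ExtVanishes R M N i)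
    (h₁ : ExtVanishes R M N (i + 1)) : ExtVanishes R M (QuotSMulTop x N) i := by
  refine subsingleton_of_forall_eq 0 fun z => ?_
  obtain ⟨w, rfl⟩ := Ext.covariant_sequence_exact₃ _ (shortExact_of_exact
    (f := LinearMap.lsmul R N x) hx (LinearMap.exact_lsmul_mkQ_smul_top N x)
    (Submodule.mkQ_surjective _)) z rfl (h₁.eq_zero _)
  rw [h₀.eq_zero w, Ext.zero_comp]

theorem ExtVanishes.quotient_ofList {xs : List R}
    (hxs : RingTheory.Sequence.IsWeaklyRegular M xs) (s : ℕ)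
    (h : ∀ i, s ≤ i → i ≤ s + xs.length → ExtVanishes R M N i) :
    ExtVanishes R (M ⧸ (Ideal.ofList xs • ⊤ : Submodule R M)) N (s + xs.length) := by
  induction xs generalizing M s with
  | nil => exact (h s le_rfl le_rfl).of_linearEquiv (Submodule.quotEquivOfEqBot _ (by simp))
  | cons x xs ih =>
    rw [RingTheory.Sequence.isWeaklyRegular_cons_iff] at hxs
    rw [List.length_cons] at h
    have hx : ∀ i, s + 1 ≤ i → i ≤ s + 1 + xs.length → ExtVanishes R (QuotSMulTop x M) N i
      | i + 1, _, _ => .quotSMulTop hxs.1 (h i (by omega) (by omega)) (h _ (by omega) (by omega))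
    rw [List.length_cons, add_comm xs.length, ← add_assoc]
    exact (ih hxs.2 (s + 1) hx).of_linearEquiv
      (Submodule.quotOfListConsSMulTopEquivQuotSMulTopInner M x xs)

theorem extVanishes_quotient_ofList_of_projective [Module.Projective R M] {xs : List R}
    (hxs : RingTheory.Sequence.IsWeaklyRegular M xs) (i : ℕ) (hi : xs.length < i) :
    ExtVanishes R (M ⧸ (Ideal.ofList xs • ⊤ : Submodule R M)) N i := by
  have h : ExtVanishes R (M ⧸ (Ideal.ofList xs • ⊤ : Submodule R M)) N
      (i - xs.length + xs.length) := .quotient_ofList hxs _ fun j hj _ => by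
    obtain ⟨j, rfl⟩ := Nat.exists_eq_add_of_le' (show 1 ≤ j by omega)
    exact extVanishes_of_projective j
  rwa [Nat.sub_add_cancel hi.le] at h

variable [IsLocalRing R] [IsNoetherianRing R] [Module.Finite R M] [Module.Finite R N]

/- Multiplication by `x` on `Extⁱ(M, N)` is surjective, so Nakayama's lemma applies. -/
theorem ExtVanishes.of_quotSMulTop {x : R} (hx : IsSMulRegular M x) (hm : x ∈ maximalIdeal R)
    (h : ExtVanishes R (QuotSMulTop x M) N (i + 1)) : ExtVanishes R M N i := by
  let E := Ext (ModuleCat.of R M) (ModuleCat.of R N) i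
  have hxE : (⊤ : Submodule R E) ≤ maximalIdeal R • ⊤ := fun y _ => by
    obtain ⟨z, hz⟩ : ∃ z : E, (Ext.mk₀ (x • 𝟙 (ModuleCat.of R M))).comp z (zero_add i) = y :=
      Ext.contravariant_sequence_exact₁ (IsSMulRegular.smulShortComplex_shortExact
        (M := ModuleCat.of R M) hx) _ y (add_comm 1 i) (h.eq_zero _)
    rw [Ext.mk₀_smul, Ext.smul_comp, Ext.mk₀_id_comp] at hz
    exact hz ▸ Submodule.smul_mem_smul hm trivial
  exact (Submodule.subsingleton_iff R).1 <| subsingleton_iff_bot_eq_top.1 <| Eq.symm <|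
    Submodule.eq_bot_of_le_smul_of_le_jacobson_bot _ _ Module.Finite.fg_top hxE
      (jacobson_eq_maximalIdeal ⊥ bot_ne_top).ge

theorem ExtVanishes.of_quotient_ofList {xs : List R}
    (hxs : RingTheory.Sequence.IsWeaklyRegular M xs) (hm : ∀ x ∈ xs, x ∈ maximalIdeal R) (i : ℕ)
    (h : ExtVanishes R (M ⧸ (Ideal.ofList xs • ⊤ : Submodule R M)) N (i + xs.length)) :
    ExtVanishes R M N i := by
  induction xs generalizing M i with
  | nil => exact h.of_linearEquiv (Submodule.quotEquivOfEqBot _ (by simp)).symm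
  | cons x xs ih =>
    rw [RingTheory.Sequence.isWeaklyRegular_cons_iff] at hxs
    rw [List.forall_mem_cons] at hm
    rw [List.length_cons, add_comm xs.length, ← add_assoc] at h
    exact .of_quotSMulTop hxs.1 hm.1 <| ih hxs.2 hm.2 (i + 1) <| h.of_linearEquiv
      (Submodule.quotOfListConsSMulTopEquivQuotSMulTopInner M x xs).symm

end RegularSequences

section BaseChange

variable {R S : Type u} [CommRing R] [CommRing S] [Algebra R S] [Module.FaithfullyFlat R S]
  {N : Type u} [AddCommGroup N] [Module R N]

theorem surjective_lcomp_baseChange_iff {K F : Type u} [AddCommGroup K] [Module R K]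
    [AddCommGroup F] [Module R F] [Module.FinitePresentation R K] [Module.FinitePresentation R F]
    (f : K →ₗ[R] F) :
    Function.Surjective (LinearMap.lcomp S (S ⊗[R] N) (f.baseChange S)) ↔
      Function.Surjective (LinearMap.lcomp R N f) := by
  have hF := Module.FinitePresentation.isBaseChange_map R F N S
  have hK := Module.FinitePresentation.isBaseChange_map R K N S
  have hcomm : LinearMap.lcomp S (S ⊗[R] N) (f.baseChange S) ∘ₗ hF.equiv.toLinearMap =
      hK.equiv.toLinearMap ∘ₗ (LinearMap.lcomp R N f).baseChange S := by
    refine TensorProduct.AlgebraTensorModule.curry_injective (LinearMap.ext fun s ↦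
      LinearMap.ext fun φ ↦ TensorProduct.AlgebraTensorModule.curry_injective
        (LinearMap.ext fun s ↦ LinearMap.ext fun m ↦ ?_))
    simp [IsBaseChange.equiv_tmul]
  rw [← Module.FaithfullyFlat.lTensor_surjective_iff_surjective R S (LinearMap.lcomp R N f),
    ← EquivLike.surjective_comp hF.equiv, ← EquivLike.comp_surjective _ hK.equiv]
  exact iff_of_eq (congrArg Function.Surjective (congrArg DFunLike.coe hcomm))

theorem extVanishes_baseChange_iff [IsNoetherianRing R] (M : Type u) [AddCommGroup M] [Module R M]
    [Module.Finite R M] (i : ℕ) :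
    ExtVanishes S (S ⊗[R] M) (S ⊗[R] N) (i + 1) ↔ ExtVanishes R M N (i + 1) := by
  induction i generalizing M with
  | zero =>
    obtain ⟨n, p, hp⟩ := Module.Finite.exists_fin' R M
    have hex := p.exact_subtype_ker_map
    have : Module.FinitePresentation R (LinearMap.ker p) := Module.finitePresentation_of_finite R _
    rw [extVanishes_one_iff (LinearMap.ker p).injective_subtype hex hp, extVanishes_one_iff
      (f := (LinearMap.ker p).subtype.baseChange S) (g := p.baseChange S)
      (Module.Flat.lTensor_preserves_injective_linearMap _ (LinearMap.ker p).injective_subtype)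
      (lTensor_exact S hex hp) (LinearMap.lTensor_surjective S hp),
      surjective_lcomp_baseChange_iff]
  | succ i ih =>
    obtain ⟨n, p, hp⟩ := Module.Finite.exists_fin' R M
    have hex := p.exact_subtype_ker_map
    rw [extVanishes_succ_iff (LinearMap.ker p).injective_subtype hex hp, extVanishes_succ_iff
      (f := (LinearMap.ker p).subtype.baseChange S) (g := p.baseChange S)
      (Module.Flat.lTensor_preserves_injective_linearMap _ (LinearMap.ker p).injective_subtype)
      (lTensor_exact S hex hp) (LinearMap.lTensor_surjective S hp), ih]

end BaseChange

/-! ### Modules of finite length -/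

section FiniteLength

variable {R : Type u} [CommRing R] [IsLocalRing R] {M : Type u} [AddCommGroup M] [Module R M]

theorem nonempty_linearEquiv_residueField [IsSimpleModule R M] :
    Nonempty (M ≃ₗ[R] ResidueField R) := by
  obtain ⟨m, hm, ⟨e⟩⟩ := isSimpleModule_iff_quot_maximal.mp ‹IsSimpleModule R M›
  rw [eq_maximalIdeal hm] at e
  exact ⟨e⟩

theorem exists_residueField_injective [Nontrivial M] [IsArtinian R M] :
    ∃ f : ResidueField R →ₗ[R] M, Function.Injective f := by
  obtain ⟨N, hN⟩ := IsAtomic.exists_atom (Submodule R M)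
  rw [← isSimpleModule_iff_isAtom] at hN
  obtain ⟨e⟩ := nonempty_linearEquiv_residueField (R := R) (M := N)
  exact ⟨N.subtype ∘ₗ e.symm.toLinearMap, N.injective_subtype.comp e.symm.injective⟩

theorem exists_residueField_retract [Nontrivial M]
    (h : maximalIdeal R ≤ Module.annihilator R M) :
    ∃ (f : ResidueField R →ₗ[R] M) (g : M →ₗ[R] ResidueField R), g ∘ₗ f = LinearMap.id := by
  have ht : Module.IsTorsionBySet R M (maximalIdeal R) := fun m a =>
    Module.mem_annihilator.1 (h a.2) m
  let _ : Module (ResidueField R) M := ht.module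
  have : IsScalarTower R (ResidueField R) M := ht.isScalarTower
  obtain ⟨v, hv⟩ := exists_ne (0 : M)
  obtain ⟨φ, hφ⟩ := Module.Projective.exists_dual_ne_zero (ResidueField R) hv
  refine ⟨(LinearMap.toSpanSingleton (ResidueField R) M ((φ v)⁻¹ • v)).restrictScalars R,
    φ.restrictScalars R, ?_⟩
  ext a
  simp [hφ]

theorem ExtVanishes.of_isFiniteLength {N : Type u} [AddCommGroup N] [Module R N] {i : ℕ}
    (hk : ExtVanishes R (ResidueField R) N i) (h : IsFiniteLength R M) : ExtVanishes R M N i := by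
  induction h with
  | of_subsingleton => exact extVanishes_of_subsingleton i
  | @of_simple_quotient M _ _ P _ _ ih =>
    obtain ⟨e⟩ := nonempty_linearEquiv_residueField (R := R) (M := M ⧸ P)
    exact .middle P.injective_subtype (LinearMap.exact_subtype_mkQ P) P.mkQ_surjective ih
      (hk.of_linearEquiv e)

theorem support_eq_of_supportDim_le_zero [Nontrivial M] (h : Module.supportDim R M ≤ 0) :
    Module.support R M = PrimeSpectrum.zeroLocus (maximalIdeal R) := by
  have := (Module.nonempty_support_of_nontrivial (R := R) (M := M)).to_subtype
  exact support_of_supportDim_eq_zero R M (h.antisymm Order.krullDim_nonneg)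

variable [IsNoetherianRing R] [Module.Finite R M]

theorem isFiniteLength_of_support_subset
    (h : Module.support R M ⊆ PrimeSpectrum.zeroLocus (maximalIdeal R)) : IsFiniteLength R M := by
  induction ‹Module.Finite R M› using IsNoetherianRing.induction_on_isQuotientEquivQuotientPrime R
    with
  | subsingleton M => exact .of_subsingleton
  | quotient M p e =>
    have hp : maximalIdeal R ≤ p.asIdeal := by
      refine @h p ?_
      rw [e.support_eq, Module.support_eq_zeroLocus, Ideal.annihilator_quotient]
      exact (PrimeSpectrum.mem_zeroLocus _ _).2 subset_rfl
    have hmax : p.asIdeal = maximalIdeal R := (le_maximalIdeal p.2.ne_top).antisymm hp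
    have : IsSimpleModule R M := isSimpleModule_iff_quot_maximal.2
      ⟨p.asIdeal, hmax ▸ maximalIdeal.isMaximal R, ⟨e⟩⟩
    exact isFiniteLength_iff_isNoetherian_isArtinian.2 ⟨inferInstance, inferInstance⟩
  | exact M₁ M₂ M₃ f g hf hg hfg h₁ h₃ =>
    rw [Module.support_of_exact hfg hf hg, Set.union_subset_iff] at h
    rw [← Module.length_ne_top_iff, Module.length_eq_add_of_exact f g hf hg hfg]
    exact WithTop.add_ne_top.2 ⟨Module.length_ne_top_iff.2 (h₁ h.1),
      Module.length_ne_top_iff.2 (h₃ h.2)⟩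

theorem isFiniteLength_of_pow_le_annihilator {n : ℕ}
    (h : maximalIdeal R ^ n ≤ Module.annihilator R M) : IsFiniteLength R M := by
  refine isFiniteLength_of_support_subset fun p hp => p.2.le_of_pow_le (h.trans ?_)
  exact Module.mem_support_iff_of_finite.1 hp

theorem isFiniteLength_quotient_of_isRegular {xs : List R}
    (hxs : RingTheory.Sequence.IsRegular M xs) (hdim : ringKrullDim R ≤ xs.length) :
    IsFiniteLength R (M ⧸ (Ideal.ofList xs • ⊤ : Submodule R M)) := by
  have := hxs.quot_ofList_smul_nontrivial ⊤
  have hle : Module.supportDim R (M ⧸ (Ideal.ofList xs • ⊤ : Submodule R M)) + xs.length ≤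
      0 + xs.length := by
    rw [Module.supportDim_add_length_eq_supportDim_of_isRegular xs hxs, zero_add]
    exact (Module.supportDim_le_ringKrullDim R M).trans hdim
  exact isFiniteLength_of_support_subset
    (support_eq_of_supportDim_le_zero (ENat.WithBot.add_le_add_natCast_right_iff.1 hle)).le

theorem exists_pow_le_annihilator_of_supportDim_le_zero [Nontrivial M]
    (h : Module.supportDim R M ≤ 0) : ∃ n, maximalIdeal R ^ n ≤ Module.annihilator R M := by
  have hsupp := support_eq_of_supportDim_le_zero h
  rw [Module.support_eq_zeroLocus, PrimeSpectrum.zeroLocus_eq_iff] at hsupp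
  exact Ideal.exists_pow_le_of_le_radical_of_fg (Ideal.le_radical.trans hsupp.ge)
    (IsNoetherian.noetherian _)

end FiniteLength

/-! ### Finite injective dimension -/

section InjectiveDimension

variable {R : Type u} [CommRing R]

theorem injective_of_extVanishes_quotient (N : Type u) [AddCommGroup N] [Module R N]
    (h : ∀ I : Ideal R, ExtVanishes R (R ⧸ I) N 1) : Module.Injective R N := by
  refine Module.Baer.iff_injective.1 fun I g => ?_
  obtain ⟨φ, hφ⟩ := (h I).surjective_lcomp I.injective_subtype (LinearMap.exact_subtype_mkQ I)
    I.mkQ_surjective g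
  exact ⟨φ, fun x hx => LinearMap.congr_fun hφ ⟨x, hx⟩⟩

theorem hasInjectiveDimensionLE_of_extVanishes_quotient (d : ℕ) (N : ModuleCat.{u} R)
    (h : ∀ I : Ideal R, ExtVanishes R (R ⧸ I) N (d + 1)) : HasInjectiveDimensionLE N d := by
  induction d generalizing N with
  | zero =>
    have := (Module.injective_iff_injective_object R N).1 (injective_of_extVanishes_quotient N h)
    exact injective_iff_hasInjectiveDimensionLT_one.1 this
  | succ d ih =>
    obtain ⟨E, hE, f, _⟩ := EnoughInjectives.presentation N
    let T := ShortComplex.mk f (Limits.cokernel.π f) (Limits.cokernel.condition f)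
    have hT : T.ShortExact := { exact := ShortComplex.exact_cokernel f }
    refine (hT.hasInjectiveDimensionLT_X₃_iff d hE).1
      (ih _ fun I => subsingleton_of_forall_eq 0 fun x => ?_)
    obtain ⟨z, rfl⟩ := Ext.covariant_sequence_exact₃ _ hT x rfl ((h I).eq_zero _)
    have : Injective T.X₂ := hE
    rw [z.eq_zero_of_injective, Ext.zero_comp]

theorem extVanishes_of_hasInjectiveDimensionLE {M N : Type u} [AddCommGroup M] [Module R M]
    [AddCommGroup N] [Module R N] {n i : ℕ} (hN : HasInjectiveDimensionLE (ModuleCat.of R N) n)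
    (hi : n < i) : ExtVanishes R M N i :=
  hN.subsingleton _ _ i hi _

variable [IsNoetherianRing R] {M N : Type u} [AddCommGroup M] [Module R M]
  [AddCommGroup N] [Module R N] [Module.Finite R M]

theorem ExtVanishes.of_forall_prime {i : ℕ}
    (h : ∀ p ∈ Module.support R M, ExtVanishes R (R ⧸ p.asIdeal) N i) : ExtVanishes R M N i := by
  induction ‹Module.Finite R M› using IsNoetherianRing.induction_on_isQuotientEquivQuotientPrime R
    with
  | subsingleton M => exact extVanishes_of_subsingleton i
  | quotient M p e =>
    refine (h p ?_).of_linearEquiv e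
    rw [e.support_eq, Module.support_eq_zeroLocus, Ideal.annihilator_quotient]
    exact (PrimeSpectrum.mem_zeroLocus _ _).2 subset_rfl
  | exact M₁ M₂ M₃ f g hf hg hfg h₁ h₃ =>
    rw [Module.support_of_exact hfg hf hg] at h
    exact .middle hf hfg hg (h₁ fun p hp => h p (.inl hp)) (h₃ fun p hp => h p (.inr hp))

variable [IsLocalRing R] [Module.Finite R N] {d : ℕ}
  (hk : ∀ i, d < i → ExtVanishes R (ResidueField R) N i)

include hk

theorem extVanishes_quotient_isPrime (p : Ideal R) (hp : p.IsPrime) (i : ℕ) (hi : d < i) :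
    ExtVanishes R (R ⧸ p) N i := by
  induction p using WellFoundedGT.induction generalizing i with
  | ind p ih =>
  by_cases hmp : maximalIdeal R ≤ p
  · exact (hk i hi).of_linearEquiv
      (Submodule.quotEquivOfEq _ _ ((le_maximalIdeal hp.ne_top).antisymm hmp))
  · obtain ⟨x, hxm, hx⟩ := SetLike.not_le_iff_exists.1 hmp
    have hreg : IsSMulRegular (R ⧸ p) x := (isSMulRegular_quotient_iff_mem_of_smul_mem _ _).2
      fun _ h => (hp.mem_or_mem h).resolve_left hx
    refine .of_quotSMulTop hreg hxm (.of_forall_prime fun q hq => ?_)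
    rw [Module.support_quotSMulTop, Module.support_eq_zeroLocus, Ideal.annihilator_quotient] at hq
    exact ih q.asIdeal (hq.1.lt_of_not_ge fun h => hx (h (hq.2 rfl))) q.2 (i + 1) (by omega)

theorem hasInjectiveDimensionLE_of_extVanishes_residueField :
    HasInjectiveDimensionLE (ModuleCat.of R N) d :=
  hasInjectiveDimensionLE_of_extVanishes_quotient d _ fun _ =>
    .of_forall_prime fun p _ => extVanishes_quotient_isPrime hk p.asIdeal p.2 _ d.lt_succ_self

end InjectiveDimension

section FiniteLengthTest

variable {R : Type u} [CommRing R] [IsLocalRing R] {X N : Type u} [AddCommGroup X] [Module R X]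
  [AddCommGroup N] [Module R N]

/- Since `k` embeds in `X`, vanishing of the top `Ext` of `k` descends from `X`. -/
theorem ExtVanishes.residueField_of_hasInjectiveDimensionLE [Nontrivial X]
    (hlen : IsFiniteLength R X) {n d : ℕ}
    (hN : HasInjectiveDimensionLE (ModuleCat.of R N) n) (hX : ∀ i, d < i → ExtVanishes R X N i)
    (i : ℕ) (hi : d < i) : ExtVanishes R (ResidueField R) N i := by
  have := (isFiniteLength_iff_isNoetherian_isArtinian.1 hlen).2
  obtain ⟨f, hf⟩ := exists_residueField_injective (R := R) (M := X)
  suffices ∀ t, ∀ i, d < i → n < i + t → ExtVanishes R (ResidueField R) N i from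
    this (n + 1) i hi (by omega)
  intro t
  induction t with
  | zero => exact fun i _ hn => extVanishes_of_hasInjectiveDimensionLE hN hn
  | succ t ih =>
    intro i hi hn
    refine .left hf (LinearMap.exact_map_mkQ_range f) (Submodule.mkQ_surjective _) (hX i hi) ?_
    exact (ih (i + 1) (by omega) (by omega)).of_isFiniteLength
      (hlen.of_surjective (Submodule.mkQ_surjective _))

end FiniteLengthTest

/-! ### Depth -/

section Depth

variable {R : Type u} [CommRing R] [IsLocalRing R] {M : Type u} [AddCommGroup M] [Module R M]
  {d : ℕ}

theorem length_le_depth {xs : List R} (hxs : RingTheory.Sequence.IsRegular M xs)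
    (hm : ∀ x ∈ xs, x ∈ maximalIdeal R) : (xs.length : ℕ∞) ≤ depth R M :=
  le_iSup₂ (f := fun (xs : List R) (_ : RingTheory.Sequence.IsRegular M xs ∧
    ∀ x ∈ xs, x ∈ maximalIdeal R) => (xs.length : ℕ∞)) xs ⟨hxs, hm⟩

theorem exists_isRegular_of_le_depth [Nontrivial M] (h : (d : ℕ∞) ≤ depth R M) :
    ∃ xs : List R, xs.length = d ∧ (∀ x ∈ xs, x ∈ maximalIdeal R) ∧
      RingTheory.Sequence.IsRegular M xs := by
  obtain _ | d := d
  · exact ⟨[], rfl, by simp, .nil R M⟩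
  · have hlt : (d : ℕ∞) < depth R M := lt_of_lt_of_le (mod_cast d.lt_succ_self) h
    simp only [depth, lt_iSup_iff] at hlt
    obtain ⟨xs, ⟨hxs, hm⟩, hd⟩ := hlt
    refine ⟨xs.take (d + 1), List.length_take_of_le (mod_cast hd),
      fun x hx => hm x (List.mem_of_mem_take hx), ⟨?_, ?_⟩⟩
    · have := hxs.toIsWeaklyRegular
      rw [← xs.take_append_drop (d + 1), RingTheory.Sequence.isWeaklyRegular_append_iff] at this
      exact this.1
    · refine fun htop => hxs.top_ne_smul (top_le_iff.1 (htop.le.trans ?_)).symm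
      exact Submodule.smul_mono_left (Ideal.span_mono fun x hx => List.mem_of_mem_take hx)

theorem smul_top_lt_top_of_le_maximalIdeal [Module.Finite R M] [Nontrivial M] {I : Ideal R}
    (hI : I ≤ maximalIdeal R) : I • (⊤ : Submodule R M) < ⊤ :=
  lt_top_iff_ne_top.2 (Submodule.top_ne_ideal_smul_of_le_jacobson_annihilator
    (hI.trans (maximalIdeal_le_jacobson _))).symm

theorem nontrivial_quotSMulTop [Module.Finite R M] [Nontrivial M] {x : R}
    (hx : x ∈ maximalIdeal R) : Nontrivial (QuotSMulTop x M) := by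
  rw [Submodule.Quotient.nontrivial_iff, ← Submodule.ideal_span_singleton_smul]
  exact (smul_top_lt_top_of_le_maximalIdeal ((Ideal.span_singleton_le_iff_mem _).2 hx)).ne

theorem le_depth_iff_extVanishes [IsNoetherianRing R] [Module.Finite R M] [Nontrivial M] :
    (d : ℕ∞) ≤ depth R M ↔ ∀ i < d, ExtVanishes R (ResidueField R) M i := by
  have hsupp : Module.support R (ModuleCat.of R (ResidueField R)) =
      PrimeSpectrum.zeroLocus (maximalIdeal R) := by
    rw [Module.support_eq_zeroLocus]
    exact congrArg (fun I : Ideal R => PrimeSpectrum.zeroLocus (I : Set R))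
      (Ideal.annihilator_quotient (I := maximalIdeal R))
  have hlt : maximalIdeal R • (⊤ : Submodule R (ModuleCat.of R M)) < ⊤ :=
    smul_top_lt_top_of_le_maximalIdeal le_rfl
  constructor
  · intro h
    obtain ⟨xs, rfl, hm, hxs⟩ := exists_isRegular_of_le_depth h
    exact ModuleCat.subsingleton_ext_of_exists_isRegular (maximalIdeal R)
      (ModuleCat.of R (ResidueField R)) hsupp.le (ModuleCat.of R M) hlt xs hm hxs
  · intro h
    obtain ⟨xs, rfl, hm, hxs⟩ := ModuleCat.exists_isRegular_of_exists_subsingleton_ext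
      (maximalIdeal R) d (ModuleCat.of R M) hlt (ModuleCat.of R (ResidueField R)) hsupp h
    exact length_le_depth hxs hm

theorem le_depth_quotSMulTop [IsNoetherianRing R] [Module.Finite R M] [Nontrivial M] {x : R}
    (hx : x ∈ maximalIdeal R) (hreg : IsSMulRegular M x) (h : ((d + 1 : ℕ) : ℕ∞) ≤ depth R M) :
    (d : ℕ∞) ≤ depth R (QuotSMulTop x M) := by
  have := nontrivial_quotSMulTop (M := M) hx
  rw [le_depth_iff_extVanishes] at h ⊢
  exact fun i hi => .quotSMulTop_right hreg (h i (by omega)) (h (i + 1) (by omega))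

theorem depth_le_depth_of_isBaseChange {S : Type u} [CommRing S] [IsLocalRing S] [Algebra R S]
    [Module.FaithfullyFlat R S] (hmap : (maximalIdeal R).map (algebraMap R S) ≤ maximalIdeal S)
    {M' : Type u} [AddCommGroup M'] [Module R M'] [Module S M'] [IsScalarTower R S M']
    {φ : M →ₗ[R] M'} (hφ : IsBaseChange S φ) : depth R M ≤ depth S M' := by
  refine iSup₂_le fun xs ⟨hxs, hm⟩ => ?_
  rw [← List.length_map (algebraMap R S)]
  refine length_le_depth (hxs.of_faithfullyFlat_of_isBaseChange hφ) fun y hy => ?_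
  obtain ⟨x, hx, rfl⟩ := List.mem_map.1 hy
  exact hmap (Ideal.mem_map_of_mem _ (hm x hx))

end Depth

section FiniteInjectiveDimension

variable {R : Type u} [CommRing R] [IsLocalRing R] [IsNoetherianRing R] {N : Type u}
  [AddCommGroup N] [Module R N] {d : ℕ}

theorem ExtVanishes.residueField_of_le_depth (hd : ringKrullDim R ≤ d)
    (hR : (d : ℕ∞) ≤ depth R R) {n : ℕ} (hN : HasInjectiveDimensionLE (ModuleCat.of R N) n)
    (i : ℕ) (hi : d < i) : ExtVanishes R (ResidueField R) N i := by
  obtain ⟨xs, rfl, -, hxs⟩ := exists_isRegular_of_le_depth hR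
  have := hxs.quot_ofList_smul_nontrivial (⊤ : Submodule R R)
  exact .residueField_of_hasInjectiveDimensionLE (isFiniteLength_quotient_of_isRegular hxs hd) hN
    (extVanishes_quotient_ofList_of_projective hxs.toIsWeaklyRegular) i hi

theorem extVanishes_of_le_depth [Module.Finite R N] {L : Type u} [AddCommGroup L] [Module R L]
    [Module.Finite R L] [Nontrivial L] (hd : ringKrullDim R ≤ d) (hR : (d : ℕ∞) ≤ depth R R)
    (hL : (d : ℕ∞) ≤ depth R L) {n : ℕ} (hN : HasInjectiveDimensionLE (ModuleCat.of R N) n)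
    (i : ℕ) (hi : 1 ≤ i) : ExtVanishes R L N i := by
  obtain ⟨ys, rfl, hm, hys⟩ := exists_isRegular_of_le_depth hL
  exact .of_quotient_ofList hys.toIsWeaklyRegular hm i <|
    (ExtVanishes.residueField_of_le_depth hd hR hN _ (by omega)).of_isFiniteLength
      (isFiniteLength_quotient_of_isRegular hys hd)

end FiniteInjectiveDimension

/-! ### General elements and superficial elements -/

section GeneralElements

variable {A M : Type*} [CommRing A] [AddCommGroup M] [Module A M]

/-- A property holds eventually along this filter if it holds for general elements of `M`, that is,
for all elements outside some finite union of proper submodules. -/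
def generalElements (A M : Type*) [CommRing A] [AddCommGroup M] [Module A M] : Filter M :=
  Filter.generate {U | ∃ p : Submodule A M, p ≠ ⊤ ∧ (p : Set M)ᶜ = U}

theorem eventually_generalElements_notMem {p : Submodule A M} (hp : p ≠ ⊤) :
    ∀ᶠ x in generalElements A M, x ∉ p :=
  Filter.mem_generate_of_mem ⟨p, hp, rfl⟩

theorem neBot_generalElements [IsLocalRing A] [Infinite (ResidueField A)] [Module.Finite A M] :
    (generalElements A M).NeBot := by
  refine Filter.generate_neBot_iff.2 fun t ht htfin => ?_
  have hchoice (U : Set M) : ∃ p : Submodule A M, U ∈ t → p ≠ ⊤ ∧ (p : Set M)ᶜ = U := by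
    by_cases hU : U ∈ t
    · exact (ht hU).imp fun p hp _ => hp
    · exact ⟨⊤, fun h => absurd h hU⟩
  choose p hp using hchoice
  by_contra! hempty
  obtain ⟨U, hU, hfin⟩ := Submodule.exists_finiteIndex_of_cover (p := p) (s := htfin.toFinset) <| by
    refine Set.eq_univ_of_forall fun x => ?_
    have hx : x ∉ ⋂₀ t := hempty ▸ Set.notMem_empty x
    simp only [Set.mem_sInter, not_forall] at hx
    obtain ⟨U, hU, hxU⟩ := hx
    rw [← (hp U hU).2, Set.notMem_compl_iff] at hxU
    exact Set.mem_biUnion (htfin.mem_toFinset.2 hU) hxU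
  obtain ⟨q, hq, hpq⟩ := (eq_top_or_exists_le_coatom (p U)).resolve_left
    (hp U (htfin.mem_toFinset.1 hU)).1
  have : Finite (M ⧸ p U) := AddSubgroup.finite_quotient_of_finiteIndex
  have : Finite (M ⧸ q) := .of_surjective _ (Submodule.factor_surjective hpq)
  have : IsSimpleModule A (M ⧸ q) := isSimpleModule_iff_isCoatom.2 hq
  obtain ⟨m, hm, ⟨e⟩⟩ := isSimpleModule_iff_quot_maximal.1 this
  rw [eq_maximalIdeal hm] at e
  have : Finite (ResidueField A) := .of_equiv _ e.toEquiv
  exact not_finite (ResidueField A)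

variable {B G : Type*} [CommRing B] [IsNoetherianRing B] [AddCommGroup G] [Module B G]
  [Module.Finite B G]

theorem eventually_span_range_le_of_mem_associatedPrimes [Algebra A B] (f : M →ₗ[A] B) :
    ∀ᶠ x in generalElements A M, ∀ P ∈ associatedPrimes B G, f x ∈ P →
      Ideal.span (Set.range f) ≤ P := by
  rw [Filter.eventually_all_finite (associatedPrimes.finite B G)]
  intro P _
  by_cases htop : (P.restrictScalars A).comap f = ⊤
  · refine .of_forall fun x _ => Ideal.span_le.2 ?_
    rintro _ ⟨y, rfl⟩
    exact htop.ge (Submodule.mem_top (x := y))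
  · filter_upwards [eventually_generalElements_notMem htop] with x hx hxP
    exact absurd hxP hx

theorem eventually_isSMulRegular {y : B} {I : Ideal B} (hy : y ∈ I)
    (hreg : IsSMulRegular G y) : ∀ᶠ x : I in generalElements B I, IsSMulRegular G (x : B) := by
  filter_upwards [eventually_span_range_le_of_mem_associatedPrimes (G := G) I.subtype] with x hx
  refine isSMulRegular_iff_right_eq_zero_of_smul.2 fun g hg => by_contra fun hne => ?_
  obtain ⟨P, hP, hxP⟩ := Set.mem_iUnion₂.1 <|
    (biUnion_associatedPrimes_eq_zero_divisors B G).ge ⟨g, hne, hg⟩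
  have hyP : y ∈ P := hx P hP hxP (Ideal.subset_span ⟨⟨y, hy⟩, rfl⟩)
  obtain ⟨z, hz, h0⟩ := (biUnion_associatedPrimes_eq_zero_divisors B G).le
    (Set.mem_iUnion₂_of_mem hP hyP)
  exact hz (hreg.right_eq_zero_of_smul h0)

theorem exists_pow_le_annihilator_torsionBy {J : Ideal B} {b : B}
    (h : ∀ P ∈ associatedPrimes B G, b ∈ P → J ≤ P) :
    ∃ c : ℕ, J ^ c ≤ Module.annihilator B (Submodule.torsionBy B G b) := by
  let K := Submodule.torsionBy B G b
  refine Ideal.exists_pow_le_of_le_radical_of_fg ?_ (IsNoetherian.noetherian J)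
  rw [← Ideal.sInf_minimalPrimes]
  refine le_sInf fun P hP => h P ?_ (hP.1.2 ?_)
  · exact associatedPrimes.subset_of_injective K.injective_subtype
      (Module.associatedPrimes.minimalPrimes_annihilator_subset_associatedPrimes B K hP)
  · exact Module.mem_annihilator.2 fun g => Subtype.ext g.2

end GeneralElements

section Superficial

variable {A : Type*} [CommRing A] (I : Ideal A) (N : Type*) [AddCommGroup N] [Module A N]

/-- The element `x` is superficial for `I` on `N`: there is a `c` with
`(I ^ (n + 1) N : x) ∩ I ^ c N ⊆ I ^ n N` for all `n ≥ c`. -/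
def IsSuperficial (x : A) : Prop :=
  ∃ c : ℕ, ∀ n ≥ c, ∀ y ∈ (I ^ c • ⊤ : Submodule A N),
    x • y ∈ (I ^ (n + 1) • ⊤ : Submodule A N) → y ∈ (I ^ n • ⊤ : Submodule A N)

/-- The inclusion of `I` as the degree one part of its Rees algebra. -/
noncomputable def reesMonomial : I →ₗ[A] reesAlgebra I :=
  ((Polynomial.monomial 1).comp I.subtype).codRestrict (Subalgebra.toSubmodule (reesAlgebra I))
    fun a => reesAlgebra.monomial_mem.2 (by simp)

theorem exists_mem_span_reesMonomial_pow {c : ℕ} {r : A} (hr : r ∈ I ^ c) :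
    ∃ b ∈ Ideal.span (Set.range (reesMonomial I)) ^ c,
      (b : Polynomial A) = Polynomial.monomial c r := by
  induction c generalizing r with
  | zero => exact ⟨algebraMap A _ r, by simp, rfl⟩
  | succ c ih =>
    rw [pow_succ] at hr
    refine Submodule.mul_induction_on hr (fun a ha b hb => ?_) ?_
    · obtain ⟨a', ha', e⟩ := ih ha
      refine ⟨a' * reesMonomial I ⟨b, hb⟩, ?_, ?_⟩
      · rw [pow_succ]
        exact Ideal.mul_mem_mul ha' (Ideal.subset_span ⟨_, rfl⟩)
      · rw [MulMemClass.coe_mul, e]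
        exact Polynomial.monomial_mul_monomial _ _ _ _
    · rintro x y ⟨a, ha, ea⟩ ⟨b, hb, eb⟩
      exact ⟨a + b, add_mem ha hb, by rw [AddMemClass.coe_add, ea, eb, map_add]⟩

/-- The filtration `I N ⊇ I ^ 2 N ⊇ ⋯`, by which the `I`-adic filtration is divided to obtain the
associated graded module. -/
def shiftedFiltration : I.Filtration N where
  N n := I ^ (n + 1) • ⊤
  mono n := Submodule.smul_mono_left (Ideal.pow_le_pow_right (by omega))
  smul_le n := by rw [← mul_smul, ← pow_succ']

/-- The submodule `⨁ Iⁿ N / Iⁿ⁺¹ N` of `N[t] / ⨁ Iⁿ⁺¹ N` underlying the associated graded module. -/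
noncomputable def associatedGradedSubmodule :
    Submodule (reesAlgebra I) (PolynomialModule A N ⧸ (shiftedFiltration I N).submodule) :=
  (I.stableFiltration ⊤).submodule.map (shiftedFiltration I N).submodule.mkQ

/-- The associated graded module `⨁ Iⁿ N / Iⁿ⁺¹ N`, as a module over the Rees algebra of `I`.
An element of `I` is superficial as soon as its degree one class avoids those associated primes of
this module that do not contain the degree one part of the Rees algebra. -/
def AssociatedGraded : Type _ := associatedGradedSubmodule I N

noncomputable instance : AddCommGroup (AssociatedGraded I N) :=
  inferInstanceAs (AddCommGroup (associatedGradedSubmodule I N))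

noncomputable instance : Module (reesAlgebra I) (AssociatedGraded I N) :=
  inferInstanceAs (Module (reesAlgebra I) (associatedGradedSubmodule I N))

instance [IsNoetherianRing A] [Module.Finite A N] :
    Module.Finite (reesAlgebra I) (AssociatedGraded I N) :=
  Module.Finite.iff_fg.2 (((Ideal.Filtration.submodule_fg_iff_stable _ fun _ =>
    IsNoetherian.noetherian _).2 (Ideal.stableFiltration_stable I ⊤)).map _)

variable {I N}

theorem single_mem_submodule_iff {F : I.Filtration N} {n : ℕ} {y : N} :
    PolynomialModule.single A n y ∈ F.submodule ↔ y ∈ F.N n := by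
  refine ⟨fun h => ?_, fun h i => ?_⟩
  · simpa only [PolynomialModule.coeff_single, Finsupp.single_eq_same] using h n
  · rw [PolynomialModule.coeff_single, Finsupp.single_apply]
    split_ifs with hi
    · exact hi ▸ h
    · exact zero_mem _

/-- The class in degree `n` of the associated graded module of an element of `Iⁿ N`. -/
noncomputable def initialForm {n : ℕ} {y : N} (hy : y ∈ (I ^ n • ⊤ : Submodule A N)) :
    AssociatedGraded I N :=
  ⟨_, Submodule.mem_map_of_mem ((single_mem_submodule_iff (F := I.stableFiltration ⊤)).2 hy)⟩

theorem smul_initialForm_eq_zero_iff {n c : ℕ} {y : N} (hy : y ∈ (I ^ n • ⊤ : Submodule A N))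
    {r : A} {b : reesAlgebra I} (hb : (b : Polynomial A) = Polynomial.monomial c r) :
    b • initialForm hy = 0 ↔ r • y ∈ (I ^ (c + n + 1) • ⊤ : Submodule A N) := by
  have h : (b : Polynomial A) • PolynomialModule.single A n y =
      PolynomialModule.single A (c + n) (r • y) := by
    rw [hb, PolynomialModule.monomial_smul_single]
  calc b • initialForm hy = 0
    _ ↔ (b : Polynomial A) • PolynomialModule.single A n y ∈ (shiftedFiltration I N).submodule :=
      Subtype.ext_iff.trans (Submodule.Quotient.mk_eq_zero _)
    _ ↔ r • y ∈ (I ^ (c + n + 1) • ⊤ : Submodule A N) := h ▸ single_mem_submodule_iff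

/-- The filtration of `N` by the submodules `Iⁿ N ∩ (Iⁿ⁺² N : x)`, which make up the kernel of
multiplication by the class of `x` on the associated graded module. -/
def colonFiltration (I : Ideal A) (N : Type*) [AddCommGroup N] [Module A N] (x : A) :
    I.Filtration N where
  N n := I ^ n • ⊤ ⊓ (I ^ (n + 2) • ⊤ : Submodule A N).comap (LinearMap.lsmul A N x)
  mono n := inf_le_inf (Submodule.smul_mono_left (Ideal.pow_le_pow_right (by omega)))
    (Submodule.comap_mono (Submodule.smul_mono_left (Ideal.pow_le_pow_right (by omega))))
  smul_le n := by
    refine Submodule.smul_le.2 fun a ha y hy => ⟨?_, ?_⟩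
    · rw [pow_succ', mul_smul]
      exact Submodule.smul_mem_smul ha hy.1
    · change x • a • y ∈ (I ^ (n + 1 + 2) • ⊤ : Submodule A N)
      rw [smul_comm, add_right_comm, pow_succ' I (n + 2), mul_smul]
      exact Submodule.smul_mem_smul ha hy.2

variable [IsNoetherianRing A] [Module.Finite A N]

theorem exists_smul_mem_of_associatedPrimes {x : I}
    (h : ∀ P ∈ associatedPrimes (reesAlgebra I) (AssociatedGraded I N), reesMonomial I x ∈ P →
      Ideal.span (Set.range (reesMonomial I)) ≤ P) :
    ∃ c : ℕ, ∀ n, I ^ c • (colonFiltration I N x).N n ≤ I ^ (n + c + 1) • ⊤ := by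
  obtain ⟨c, hc⟩ := exists_pow_le_annihilator_torsionBy h
  refine ⟨c, fun n => Submodule.smul_le.2 fun r hr y hy => ?_⟩
  have hx : reesMonomial I x • initialForm hy.1 = 0 := by
    rw [smul_initialForm_eq_zero_iff hy.1 (r := (x : A)) (c := 1) rfl,
      add_comm 1 n]
    exact hy.2
  obtain ⟨b, hb, hbr⟩ := exists_mem_span_reesMonomial_pow I hr
  rw [add_comm n c, ← smul_initialForm_eq_zero_iff hy.1 hbr]
  exact congrArg Subtype.val (Module.mem_annihilator.1 (hc hb) ⟨_, hx⟩)

theorem isSuperficial_of_associatedPrimes {x : I}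
    (h : ∀ P ∈ associatedPrimes (reesAlgebra I) (AssociatedGraded I N), reesMonomial I x ∈ P →
      Ideal.span (Set.range (reesMonomial I)) ≤ P) : IsSuperficial I N (x : A) := by
  obtain ⟨c, hc⟩ := exists_smul_mem_of_associatedPrimes h
  obtain ⟨m, hm⟩ := ((I.stableFiltration_stable (⊤ : Submodule A N)).of_le
    (F' := colonFiltration I N x) (fun n => inf_le_left)).exists_pow_smul_eq
  have hstep (j : ℕ) : (colonFiltration I N x).N (m + c + j) ≤ I ^ (m + c + j + 1) • ⊤ := by
    rw [show m + c + j = m + (j + c) by ring, hm, pow_add, mul_smul,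
      show m + (j + c) + 1 = j + (m + c + 1) by ring, pow_add I j, mul_smul]
    exact Submodule.smul_mono le_rfl (hc m)
  refine ⟨m + c, fun n hn y hy hxy => ?_⟩
  obtain ⟨k, rfl⟩ := Nat.exists_eq_add_of_le hn
  induction k with
  | zero => exact hy
  | succ k ih =>
    exact hstep k ⟨ih (by omega)
      (Submodule.smul_mono_left (Ideal.pow_le_pow_right (by omega)) hxy), hxy⟩

variable (I N) in
theorem eventually_isSuperficial :
    ∀ᶠ x : I in generalElements A I, IsSuperficial I N (x : A) := by
  filter_upwards [eventually_span_range_le_of_mem_associatedPrimes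
    (G := AssociatedGraded I N) (reesMonomial I)] with x hx
  exact isSuperficial_of_associatedPrimes hx

theorem exists_mem_of_smul_mem (I : Ideal A) {x : A} (hx : IsSMulRegular N x) :
    ∃ k : ℕ, ∀ n, ∀ y : N, x • y ∈ (I ^ (n + k) • ⊤ : Submodule A N) →
      y ∈ (I ^ n • ⊤ : Submodule A N) := by
  obtain ⟨k, hk⟩ := Ideal.exists_pow_inf_eq_pow_smul I (LinearMap.range (LinearMap.lsmul A N x))
  refine ⟨k, fun n y hy => ?_⟩
  have hxy : x • y ∈ I ^ (n + k) • ⊤ ⊓ LinearMap.range (LinearMap.lsmul A N x) := ⟨hy, y, rfl⟩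
  rw [hk _ (by omega), Nat.add_sub_cancel] at hxy
  have hxy' := Submodule.smul_mono le_rfl inf_le_right hxy
  rw [LinearMap.range_eq_map, ← Submodule.map_smul''] at hxy'
  obtain ⟨z, hz, e⟩ := hxy'
  rwa [← hx e]

theorem IsSuperficial.eventually_mem_of_smul_mem {x : A} (h : IsSuperficial I N x)
    (hx : IsSMulRegular N x) : ∀ᶠ n in Filter.atTop, ∀ y : N,
      x • y ∈ (I ^ (n + 1) • ⊤ : Submodule A N) → y ∈ (I ^ n • ⊤ : Submodule A N) := by
  obtain ⟨c, hc⟩ := h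
  obtain ⟨k, hk⟩ := exists_mem_of_smul_mem I hx
  filter_upwards [Filter.eventually_ge_atTop (c + k)] with n hn y hy
  refine hc n (by omega) y (hk c y ?_) hy
  exact Submodule.smul_mono_left (Ideal.pow_le_pow_right (by omega)) hy

end Superficial

/-! ### Hilbert polynomials -/

section Length

variable {A : Type*} [CommRing A]

theorem length_quotient_eq_add {M N : Type*} [AddCommGroup M] [Module A M] [AddCommGroup N]
    [Module A N] (f : M →ₗ[A] N) (U : Submodule A N) :
    Module.length A (N ⧸ U) =
      Module.length A (M ⧸ U.comap f) + Module.length A (N ⧸ LinearMap.range f ⊔ U) := by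
  refine Module.length_eq_add_of_exact ((U.comap f).mapQ U f le_rfl)
    (Submodule.factor le_sup_right) ?_ (Submodule.factor_surjective _) ?_
  · rw [← LinearMap.ker_eq_bot, Submodule.ker_mapQ, Submodule.mkQ_map_self]
  · rw [LinearMap.exact_iff, Submodule.range_mapQ, Submodule.factor, Submodule.ker_mapQ,
      Submodule.comap_id, Submodule.map_sup, Submodule.mkQ_map_self, sup_bot_eq]

variable {N : Type*} [AddCommGroup N] [Module A N]

theorem length_quotient_pow_succ {I : Ideal A} {x : A} (hx : x ∈ I) {n : ℕ}
    (h : ∀ y : N, x • y ∈ (I ^ (n + 1) • ⊤ : Submodule A N) → y ∈ (I ^ n • ⊤ : Submodule A N)) :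
    Module.length A (N ⧸ (I ^ (n + 1) • ⊤ : Submodule A N)) =
      Module.length A (N ⧸ (I ^ n • ⊤ : Submodule A N)) +
      Module.length A (QuotSMulTop x N ⧸ (I ^ (n + 1) • ⊤ : Submodule A (QuotSMulTop x N))) := by
  have hcomap : (I ^ (n + 1) • ⊤ : Submodule A N).comap (LinearMap.lsmul A N x) = I ^ n • ⊤ := by
    refine le_antisymm h (Submodule.map_le_iff_le_comap.1 ?_)
    rw [pow_succ', mul_smul]
    exact Submodule.map_le_iff_le_comap.2 fun y hy => Submodule.smul_mem_smul hx hy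
  have hrange : LinearMap.range (LinearMap.lsmul A N x) = x • ⊤ := LinearMap.range_eq_map _
  have hmap : (I ^ (n + 1) • ⊤ : Submodule A (QuotSMulTop x N)) =
      (I ^ (n + 1) • ⊤ : Submodule A N).map (x • (⊤ : Submodule A N)).mkQ := by
    rw [Submodule.map_smul'', Submodule.map_top, Submodule.range_mkQ]
  rw [length_quotient_eq_add (LinearMap.lsmul A N x), hcomap, hrange, hmap,
    (Submodule.quotientQuotientEquivQuotientSup _ _).length_eq]

theorem length_quotient_maximalIdeal_pow_ne_top {A N : Type u} [CommRing A] [IsLocalRing A]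
    [IsNoetherianRing A] [AddCommGroup N] [Module A N] [Module.Finite A N] (n : ℕ) :
    Module.length A (N ⧸ (maximalIdeal A ^ n • ⊤ : Submodule A N)) ≠ ⊤ := by
  rw [Module.length_ne_top_iff]
  refine isFiniteLength_of_pow_le_annihilator (R := A) (n := n) ?_
  rw [Submodule.annihilator_quotient]
  exact fun a ha => Submodule.mem_colon.2 fun y _ => Submodule.smul_mem_smul ha trivial

end Length

section Polynomial

open Polynomial

variable {P : ℚ[X]}

theorem coeff_sub_comp_X_sub_one {n : ℕ} (h : P.natDegree ≤ n + 1) :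
    (P - P.comp (X - C 1)).coeff n = (n + 1) * P.coeff (n + 1) := by
  have htaylor : P.comp (X - C 1) = taylor (-1) P := by simp [taylor_apply, sub_eq_add_neg]
  have hdeg : (hasseDeriv n P).natDegree < 2 :=
    lt_of_le_of_lt (natDegree_hasseDeriv_le P n) (by omega)
  rw [coeff_sub, htaylor, taylor_coeff, eval_eq_sum_range' hdeg]
  simp [Finset.sum_range_succ, hasseDeriv_coeff, add_comm 1 n]

theorem natDegree_le_succ_of_sub_comp {d : ℕ} (h : (P - P.comp (X - C 1)).natDegree ≤ d) :
    P.natDegree ≤ d + 1 := by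
  by_contra! hlt
  obtain ⟨n, hn⟩ : ∃ n, P.natDegree = n + 1 := ⟨P.natDegree - 1, by omega⟩
  have hcoeff := coeff_sub_comp_X_sub_one hn.le
  rw [coeff_eq_zero_of_natDegree_lt (by omega)] at hcoeff
  have hne : P.coeff (n + 1) ≠ 0 := by
    rw [← hn]
    exact leadingCoeff_ne_zero.2 fun h0 => by simp [h0] at hn
  exact mul_ne_zero (by positivity) hne hcoeff.symm

theorem eq_C_of_eventually_eval_eq {c : ℚ} (h : ∀ᶠ n : ℕ in Filter.atTop, c = P.eval (n : ℚ)) :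
    P = C c := by
  obtain ⟨m, hm⟩ := Filter.eventually_atTop.1 h
  refine eq_of_infinite_eval_eq _ _ (Set.infinite_of_injective_forall_mem
    (f := fun n : ℕ => ((n + m : ℕ) : ℚ)) (fun a b hab => by simpa using hab) fun n => ?_)
  rw [Set.mem_ofPred_eq, eval_C, ← hm _ (by omega)]

/-- `P` is the Hilbert polynomial of `N` with respect to `I`: the length of `N ⧸ I ^ (n + 1) N` is
`P n` for `n ≫ 0`. An infinite length counts as `0` here. -/
def IsHilbertPolynomial {A : Type*} [CommRing A] (I : Ideal A) (N : Type*) [AddCommGroup N]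
    [Module A N] (P : ℚ[X]) : Prop :=
  ∀ᶠ n : ℕ in Filter.atTop,
    ((Module.length A (N ⧸ (I ^ (n + 1) • ⊤ : Submodule A N))).toNat : ℚ) = P.eval (n : ℚ)

variable {A : Type*} [CommRing A] {N : Type*} [AddCommGroup N] [Module A N]

theorem IsHilbertPolynomial.eq_C {I : Ideal A} (hP : IsHilbertPolynomial I N P) {m : ℕ}
    (hm : I ^ m ≤ Module.annihilator A N) : P = C ((Module.length A N).toNat : ℚ) := by
  refine eq_C_of_eventually_eval_eq ?_
  filter_upwards [hP, Filter.eventually_ge_atTop m] with n hn hmn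
  have hbot : (I ^ (n + 1) • ⊤ : Submodule A N) = ⊥ := by
    rw [eq_bot_iff, ← Submodule.annihilator_smul ⊤, Submodule.annihilator_top]
    exact Submodule.smul_mono_left ((Ideal.pow_le_pow_right (by omega)).trans hm)
  rw [← hn, hbot, (Submodule.quotEquivOfEqBot ⊥ rfl).length_eq]

theorem IsHilbertPolynomial.quotSMulTop {A N : Type u} [CommRing A] [IsLocalRing A]
    [IsNoetherianRing A] [AddCommGroup N] [Module A N] [Module.Finite A N]
    (hP : IsHilbertPolynomial (maximalIdeal A) N P) {x : A} (hx : x ∈ maximalIdeal A)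
    (hreg : IsSMulRegular N x) (hsup : IsSuperficial (maximalIdeal A) N x) :
    IsHilbertPolynomial (maximalIdeal A) (QuotSMulTop x N) (P - P.comp (X - C 1)) := by
  filter_upwards [hP, (Filter.tendsto_sub_atTop_nat 1).eventually hP, Filter.eventually_ge_atTop 1,
    hsup.eventually_mem_of_smul_mem hreg] with n hn hpred hpos hmem
  rw [Nat.sub_add_cancel hpos, Nat.cast_sub hpos, Nat.cast_one] at hpred
  rw [length_quotient_pow_succ hx hmem, ENat.toNat_add (length_quotient_maximalIdeal_pow_ne_top _)
    (length_quotient_maximalIdeal_pow_ne_top _)] at hn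
  rw [eval_sub, eval_comp, ← hn, eval_sub, eval_X, eval_C, ← hpred, Nat.cast_add,
    add_sub_cancel_left]

end Polynomial

section Multiplicity

variable {A : Type u} [CommRing A] [IsLocalRing A]

theorem exists_isSMulRegular_of_succ_le_depth {N : Type u} [AddCommGroup N] [Module A N]
    [Nontrivial N] {d : ℕ} (h : ((d + 1 : ℕ) : ℕ∞) ≤ depth A N) :
    ∃ y ∈ maximalIdeal A, IsSMulRegular N y := by
  obtain ⟨_ | ⟨y, ys⟩, hlen, hm, hys⟩ := exists_isRegular_of_le_depth h
  · simp at hlen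
  · exact ⟨y, hm y (by simp), ((RingTheory.Sequence.isRegular_cons_iff _ _ _).1 hys).1⟩

open Polynomial in
theorem exists_isRegular_length_eq [IsNoetherianRing A] [Infinite (ResidueField A)] {d : ℕ}
    (N L : Type u) [AddCommGroup N] [Module A N] [Module.Finite A N] [Nontrivial N]
    [AddCommGroup L] [Module A L] [Module.Finite A L] [Nontrivial L]
    (hN : (d : ℕ∞) ≤ depth A N) (hL : (d : ℕ∞) ≤ depth A L) (hdim : Module.supportDim A N ≤ d)
    {P : ℚ[X]} (hP : IsHilbertPolynomial (maximalIdeal A) N P) :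
    ∃ xs : List A, xs.length = d ∧ (∀ x ∈ xs, x ∈ maximalIdeal A) ∧
      RingTheory.Sequence.IsRegular N xs ∧ RingTheory.Sequence.IsRegular L xs ∧
      P.natDegree ≤ d ∧
      ((Module.length A (N ⧸ (Ideal.ofList xs • ⊤ : Submodule A N))).toNat : ℚ) =
        (d.factorial : ℚ) * P.coeff d := by
  induction d generalizing N L P with
  | zero =>
    obtain ⟨m, hm⟩ := exists_pow_le_annihilator_of_supportDim_le_zero hdim
    rw [hP.eq_C hm]
    refine ⟨[], rfl, by simp, .nil A N, .nil A L, (natDegree_C _).le, ?_⟩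
    rw [Ideal.ofList_nil, Submodule.bot_smul, (Submodule.quotEquivOfEqBot ⊥ rfl).length_eq]
    simp
  | succ d ih =>
    obtain ⟨y, hy, hyN⟩ := exists_isSMulRegular_of_succ_le_depth hN
    obtain ⟨z, hz, hzL⟩ := exists_isSMulRegular_of_succ_le_depth hL
    have := neBot_generalElements (A := A) (M := maximalIdeal A)
    obtain ⟨⟨x, hx⟩, ⟨hxN, hxL⟩, hsup⟩ := (((eventually_isSMulRegular hy hyN).and
      (eventually_isSMulRegular hz hzL)).and (eventually_isSuperficial (maximalIdeal A) N)).exists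
    have := nontrivial_quotSMulTop (M := N) hx
    have := nontrivial_quotSMulTop (M := L) hx
    rw [← Module.supportDim_quotSMulTop_succ_eq_supportDim hxN hx, Nat.cast_add,
      Nat.cast_one] at hdim
    obtain ⟨xs, hlen, hxs, hxsN, hxsL, hdeg, hlength⟩ := ih (QuotSMulTop x N) (QuotSMulTop x L)
      (le_depth_quotSMulTop hx hxN hN) (le_depth_quotSMulTop hx hxL hL)
      (ENat.WithBot.add_le_add_one_right_iff.1 hdim) (hP.quotSMulTop hx hxN hsup)
    have hdegP := natDegree_le_succ_of_sub_comp hdeg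
    refine ⟨x :: xs, by simp [hlen], by simpa using ⟨hx, hxs⟩,
      (RingTheory.Sequence.isRegular_cons_iff _ _ _).2 ⟨hxN, hxsN⟩,
      (RingTheory.Sequence.isRegular_cons_iff _ _ _).2 ⟨hxL, hxsL⟩, hdegP, ?_⟩
    rw [(Submodule.quotOfListConsSMulTopEquivQuotSMulTopInner N x xs).length_eq, hlength,
      coeff_sub_comp_X_sub_one hdegP, Nat.factorial_succ]
    push_cast
    ring

end Multiplicity

/-! ### Minimal multiplicity -/

section Length

variable {A : Type*} [CommRing A]

theorem le_of_length_quotient_le {N : Type*} [AddCommGroup N] [Module A N] {U V : Submodule A N}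
    (hUV : U ≤ V) (hfin : Module.length A (N ⧸ V) ≠ ⊤)
    (h : Module.length A (N ⧸ U) ≤ Module.length A (N ⧸ V)) : V ≤ U := by
  have hadd := length_quotient_eq_add V.subtype U
  rw [Submodule.range_subtype, sup_eq_left.2 hUV] at hadd
  have hzero : Module.length A (V ⧸ U.comap V.subtype) = 0 := by
    by_contra hne
    rw [hadd] at h
    exact h.not_gt (ENat.lt_add_left hfin (pos_iff_ne_zero.2 hne))
  rw [Module.length_eq_zero_iff, Submodule.Quotient.subsingleton_iff,
    Submodule.comap_subtype_eq_top] at hzero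
  exact hzero

theorem length_quotient_le_of_le {N : Type*} [AddCommGroup N] [Module A N] {U V : Submodule A N}
    (hUV : U ≤ V) : Module.length A (N ⧸ V) ≤ Module.length A (N ⧸ U) :=
  Module.length_le_of_surjective (Submodule.factor hUV) (Submodule.factor_surjective hUV)

variable [IsLocalRing A]

theorem length_residueField : Module.length A (ResidueField A) = 1 :=
  have : IsSimpleModule A (A ⧸ maximalIdeal A) :=
    isSimpleModule_iff_isCoatom.2 (maximalIdeal.isMaximal A).out
  Module.length_eq_one A (A ⧸ maximalIdeal A)

theorem length_quotient_pi_maximalIdeal (ι : Type*) [Fintype ι] :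
    Module.length A ((ι → A) ⧸ Submodule.pi Set.univ fun _ : ι => maximalIdeal A) =
      Fintype.card ι := by
  classical
  have hk : Module.length A (A ⧸ maximalIdeal A) = 1 := length_residueField
  simp only [(Submodule.quotientPi fun _ : ι => maximalIdeal A).length_eq,
    Module.length_pi_of_fintype, hk, Finset.sum_const, Finset.card_univ, nsmul_one]

theorem length_quotient_maximalIdeal_sq [IsNoetherianRing A] :
    Module.length A (A ⧸ maximalIdeal A ^ 2) = 1 + (maximalIdeal A).spanFinrank := by
  have hcomap : Submodule.comap (maximalIdeal A).subtype (maximalIdeal A ^ 2) =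
      maximalIdeal A • ⊤ := by
    ext x
    rw [Submodule.mem_comap, Submodule.subtype_apply, ← Ideal.mem_toCotangent_ker]
    exact SetLike.ext_iff.1 (Submodule.ker_mkQ (maximalIdeal A • ⊤)) x
  have hlen : Module.length A (maximalIdeal A).Cotangent = (maximalIdeal A).spanFinrank := by
    rw [spanFinrank_maximalIdeal_eq_finrank_cotangentSpace, ← Module.length_eq_finrank]
    exact Module.length_eq_of_surjective (M := CotangentSpace A) (residue_surjective (R := A))
  rw [length_quotient_eq_add (maximalIdeal A).subtype, hcomap, Submodule.range_subtype,
    sup_eq_left.2 (Ideal.pow_le_self two_ne_zero), add_comm]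
  exact congrArg₂ (· + ·) length_residueField hlen

end Length

section MinimalReduction

theorem ofList_take_eq_span_image {A : Type*} [CommRing A] (xs : List A) (j : ℕ) :
    Ideal.ofList (xs.take j) = Ideal.span (xs.get '' {i | i < j}) := by
  refine congrArg Ideal.span (Set.ext fun a => ?_)
  change a ∈ xs.take j ↔ ∃ i : Fin xs.length, (i : ℕ) < j ∧ xs.get i = a
  simp only [List.mem_take_iff_getElem, lt_min_iff, Fin.exists_iff, List.get_eq_getElem]
  exact ⟨fun ⟨i, hi, h⟩ => ⟨i, hi.2, hi.1, h⟩, fun ⟨i, hi, hij, h⟩ => ⟨i, ⟨hij, hi⟩, h⟩⟩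

variable {A : Type*} [CommRing A] [IsLocalRing A]

section Family

variable {ι : Type*} [Fintype ι] {x : ι → A}

theorem pi_maximalIdeal_le_comap_linearCombination (hx : ∀ i, x i ∈ maximalIdeal A) :
    Submodule.pi Set.univ (fun _ : ι => maximalIdeal A) ≤
      Submodule.comap (Fintype.linearCombination A x) (maximalIdeal A ^ 2) := by
  intro r hr
  rw [Submodule.mem_comap, Fintype.linearCombination_apply, sq]
  exact Submodule.sum_mem _ fun i _ => Ideal.mul_mem_mul (hr i trivial) (hx i)

/-- Comparing the two sides of
`length (A/𝔪²) = length (Aⁿ/{r | ∑ rᵢ xᵢ ∈ 𝔪²}) + length (A/((x) + 𝔪²))`. -/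
theorem sq_le_span_and_comap_le [IsNoetherianRing A] (hx : ∀ i, x i ∈ maximalIdeal A)
    (hlen : Module.length A (A ⧸ Ideal.span (Set.range x)) + Fintype.card ι =
      1 + (maximalIdeal A).spanFinrank) :
    maximalIdeal A ^ 2 ≤ Ideal.span (Set.range x) ∧
      Submodule.comap (Fintype.linearCombination A x) (maximalIdeal A ^ 2) ≤
        Submodule.pi Set.univ fun _ : ι => maximalIdeal A := by
  have hadd := length_quotient_eq_add (Fintype.linearCombination A x) (maximalIdeal A ^ 2)
  have hle := pi_maximalIdeal_le_comap_linearCombination hx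
  have hcard := length_quotient_le_of_le hle
  rw [length_quotient_pi_maximalIdeal] at hcard
  have hspan := length_quotient_le_of_le
    (le_sup_left : Ideal.span (Set.range x) ≤ Ideal.span (Set.range x) ⊔ maximalIdeal A ^ 2)
  rw [length_quotient_maximalIdeal_sq, Fintype.range_linearCombination, ← hlen] at hadd
  have hfin : Module.length A (A ⧸ Ideal.span (Set.range x)) ≠ ⊤ := fun h => by
    rw [h, top_add] at hlen
    exact ENat.top_ne_natCast _ (by exact_mod_cast hlen)
  have hspan' : Module.length A (A ⧸ Ideal.span (Set.range x)) ≤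
      Module.length A (A ⧸ Ideal.span (Set.range x) ⊔ maximalIdeal A ^ 2) :=
    (ENat.add_le_add_iff_right (ENat.natCast_ne_top (Fintype.card ι))).1 <|
      hadd.trans_le (by rw [add_comm]; gcongr)
  have hcard' : (Fintype.card ι : ℕ∞) ≤ Module.length A
      ((ι → A) ⧸ Submodule.comap (Fintype.linearCombination A x) (maximalIdeal A ^ 2)) :=
    (ENat.add_le_add_iff_left hfin).1 <|
      hadd.trans_le ((add_le_add le_rfl hspan).trans_eq (add_comm _ _))
  refine ⟨le_sup_right.trans (le_of_length_quotient_le le_sup_left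
    (ne_top_of_le_ne_top hfin hspan) hspan'), le_of_length_quotient_le hle
      (ne_top_of_le_ne_top (ENat.natCast_ne_top _) hcard) ?_⟩
  rwa [length_quotient_pi_maximalIdeal]

theorem span_image_inf_sq_le
    (hx : Submodule.comap (Fintype.linearCombination A x) (maximalIdeal A ^ 2) ≤
      Submodule.pi Set.univ fun _ : ι => maximalIdeal A) (s : Set ι) :
    Ideal.span (x '' s) ⊓ maximalIdeal A ^ 2 ≤ Ideal.span (x '' s) * maximalIdeal A := by
  rintro a ⟨ha, hsq⟩
  obtain ⟨l, hl, rfl⟩ := (Finsupp.mem_span_image_iff_linearCombination A).1 ha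
  refine Submodule.sum_mem _ fun i hi => ?_
  have heq : Fintype.linearCombination A x l = Finsupp.linearCombination A x l := by
    rw [← Finsupp.linearCombination_eq_fintype_linearCombination_apply A]
    exact congrArg _ (Finsupp.ext fun _ => rfl)
  rw [SetLike.mem_coe, ← heq] at hsq
  have hli : l i ∈ maximalIdeal A := hx hsq i trivial
  rw [mul_comm]
  exact Ideal.mul_mem_mul hli (Ideal.subset_span ⟨i, hl hi, rfl⟩)

end Family

/-- The elements of `xs` minimally generate a reduction of the maximal ideal `𝔪` with reduction
number at most one. Minimality enters in the form of independence modulo `𝔪 ^ 2`. -/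
structure IsMinimalReduction (xs : List A) : Prop where
  mem : ∀ x ∈ xs, x ∈ maximalIdeal A
  sq_le : maximalIdeal A ^ 2 ≤ Ideal.ofList xs * maximalIdeal A
  take_inf_sq_le (j : ℕ) :
    Ideal.ofList (xs.take j) ⊓ maximalIdeal A ^ 2 ≤ Ideal.ofList (xs.take j) * maximalIdeal A

theorem isMinimalReduction_of_length_quotient [IsNoetherianRing A] {xs : List A}
    (hm : ∀ x ∈ xs, x ∈ maximalIdeal A)
    (hlen : Module.length A (A ⧸ Ideal.ofList xs) + xs.length =
      1 + (maximalIdeal A).spanFinrank) : IsMinimalReduction xs := by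
  have hspan : Ideal.ofList xs = Ideal.span (Set.range xs.get) := by
    rw [Set.range_list_get]
  obtain ⟨hsq, hcomap⟩ := sq_le_span_and_comap_le (x := xs.get) (fun i => hm _ (xs.get_mem i))
    (by rw [← hspan, Fintype.card_fin, hlen])
  have hinf (j : ℕ) := ofList_take_eq_span_image xs j ▸ span_image_inf_sq_le hcomap {i | i < j}
  refine ⟨hm, ?_, hinf⟩
  have := hinf xs.length
  rw [List.take_length] at this
  exact (le_inf (hsq.trans hspan.ge) le_rfl).trans this

end MinimalReduction

section Multiplicity

variable {A : Type u} [CommRing A] [IsLocalRing A] [IsNoetherianRing A]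

theorem HasMinimalMultiplicity.exists_isMinimalReduction [Infinite (ResidueField A)]
    (hmult : HasMinimalMultiplicity A) {d : ℕ} (hd : ringKrullDim A = d)
    (hA : (d : ℕ∞) ≤ depth A A) (L : Type u) [AddCommGroup L] [Module A L] [Module.Finite A L]
    [Nontrivial L] (hL : (d : ℕ∞) ≤ depth A L) :
    ∃ xs : List A, xs.length = d ∧ RingTheory.Sequence.IsRegular A xs ∧
      RingTheory.Sequence.IsRegular L xs ∧ IsMinimalReduction xs := by
  obtain ⟨e, d', ⟨P, hP, he⟩, hd', hed⟩ := hmult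
  obtain rfl : d' = d := by exact_mod_cast hd'.symm.trans hd
  have hilb : IsHilbertPolynomial (maximalIdeal A) A P := by
    filter_upwards [hP] with n hn
    rw [← hn, smul_eq_mul, Ideal.mul_top]
  obtain ⟨xs, rfl, hm, hxA, hxL, hdeg, hlen⟩ := exists_isRegular_length_eq A L hA hL
    ((Module.supportDim_self_eq_ringKrullDim A).trans hd).le hilb
  have hfin := isFiniteLength_quotient_of_isRegular hxA hd.le
  have := hxA.quot_ofList_smul_nontrivial ⊤
  rw [smul_eq_mul, Ideal.mul_top] at hlen hfin this
  rw [← Module.length_ne_top_iff] at hfin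
  have hpos : (Module.length A (A ⧸ Ideal.ofList xs)).toNat ≠ 0 :=
    fun h => (ENat.toNat_eq_zero.1 h).elim Module.length_pos.ne' hfin
  have hdeg' : P.natDegree = xs.length := by
    refine hdeg.antisymm (le_of_not_gt fun hlt => hpos ?_)
    rw [Polynomial.coeff_eq_zero_of_natDegree_lt hlt, mul_zero] at hlen
    exact_mod_cast hlen
  have hel : (Module.length A (A ⧸ Ideal.ofList xs)).toNat = e := by
    rw [← hdeg'] at hlen
    exact_mod_cast hlen.trans he.symm
  refine ⟨xs, rfl, hxA, hxL, isMinimalReduction_of_length_quotient hm ?_⟩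
  rw [← ENat.natCast_toNat hfin, hel]
  exact_mod_cast (by omega : e + xs.length = 1 + (maximalIdeal A).spanFinrank)

end Multiplicity

/-! ### Syzygies of the residue field -/

section Free

variable {A F : Type*} [CommRing A] [AddCommGroup F] [Module A F]

theorem mem_ideal_smul_top_iff_repr {ι : Type*} (b : Module.Basis ι A F) (I : Ideal A) (x : F) :
    x ∈ I • (⊤ : Submodule A F) ↔ ∀ i, b.repr x i ∈ I := by
  refine ⟨fun hx i => ?_, fun h => ?_⟩
  · have hmem : b.coord i x ∈ (I • (⊤ : Submodule A F)).map (b.coord i) :=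
      Submodule.mem_map_of_mem hx
    have hle : (I • (⊤ : Submodule A F)).map (b.coord i) ≤ I := by
      rw [Submodule.map_smul'']
      exact Ideal.mul_le_left.trans_eq' (smul_eq_mul ..)
    exact hle hmem
  · rw [← b.linearCombination_repr x, Finsupp.linearCombination_apply, Finsupp.sum]
    exact Submodule.sum_mem _ fun i _ => Submodule.smul_mem_smul (h i) trivial

theorem smul_top_inf_smul_top_le [Module.Free A F] {I J K : Ideal A} (h : I ⊓ J ≤ K) :
    (I • (⊤ : Submodule A F)) ⊓ (J • ⊤) ≤ K • ⊤ := by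
  rintro x ⟨hI, hJ⟩
  have b := Module.Free.chooseBasis A F
  rw [SetLike.mem_coe, mem_ideal_smul_top_iff_repr b] at hI hJ
  exact (mem_ideal_smul_top_iff_repr b K x).2 fun i => h ⟨hI i, hJ i⟩

theorem isWeaklyRegular_of_flat [Module.Flat A F] {xs : List A}
    (h : RingTheory.Sequence.IsWeaklyRegular A xs) : RingTheory.Sequence.IsWeaklyRegular F xs :=
  ((TensorProduct.lid A F).isWeaklyRegular_congr xs).1 h.isWeaklyRegular_rTensor

end Free

theorem ofList_take_succ {A : Type*} [CommRing A] (xs : List A) {j : ℕ} (hj : j < xs.length) :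
    Ideal.ofList (xs.take (j + 1)) = Ideal.ofList (xs.take j) ⊔ Ideal.span {xs[j]} := by
  rw [List.take_add_one, List.getElem?_eq_getElem hj, Ideal.ofList_append, Option.toList_some,
    Ideal.ofList_singleton]

section Syzygies

variable {A : Type*} [CommRing A] [IsLocalRing A]

/-- The elements of `xs` behave on `𝔪M` like a regular sequence, except that the ideals they
generate multiply `M` and not `𝔪M`. This is the property of the syzygies of the residue field that
can be proved by induction along the resolution. -/
def IsRegularOnMaximalIdealSMul (xs : List A) (M : Type*) [AddCommGroup M] [Module A M] : Prop :=
  ∀ (j : ℕ) (hj : j < xs.length), ∀ w ∈ maximalIdeal A • (⊤ : Submodule A M),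
    xs[j] • w ∈ Ideal.ofList (xs.take j) • (⊤ : Submodule A M) →
      w ∈ Ideal.ofList (xs.take j) • (⊤ : Submodule A M)

theorem isRegularOnMaximalIdealSMul_of_smul_eq_bot (xs : List A) {M : Type*} [AddCommGroup M]
    [Module A M] (h : maximalIdeal A • (⊤ : Submodule A M) = ⊥) :
    IsRegularOnMaximalIdealSMul xs M := by
  intro j _ w hw _
  rw [h, Submodule.mem_bot] at hw
  exact hw ▸ zero_mem _

variable {xs : List A} {K F M : Type*} [AddCommGroup K] [Module A K] [AddCommGroup F]
  [Module A F] [AddCommGroup M] [Module A M] {ι : K →ₗ[A] F} {p : F →ₗ[A] M}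

theorem exists_map_sub_smul_mem (hιp : Function.Exact ι p) (hp : Function.Surjective p)
    {J : Ideal A} {x : A} (hx : x ∈ maximalIdeal A)
    (hM : ∀ z ∈ maximalIdeal A • (⊤ : Submodule A M),
      x • z ∈ J • (⊤ : Submodule A M) → z ∈ J • (⊤ : Submodule A M)) {w : K}
    (hw : ι w ∈ (J ⊔ Ideal.span {x}) • maximalIdeal A • (⊤ : Submodule A F)) :
    ∃ w', ι (w - x • w') ∈ J • maximalIdeal A • (⊤ : Submodule A F) := by
  have hmap (I : Ideal A) : (I • (⊤ : Submodule A F)).map p = I • (⊤ : Submodule A M) := by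
    rw [Submodule.map_smul'', Submodule.map_top, LinearMap.range_eq_top.2 hp]
  rw [Submodule.sup_smul, Submodule.ideal_span_singleton_smul] at hw
  obtain ⟨v, hv, _, ⟨u, hu, rfl⟩, hvu⟩ := Submodule.mem_sup.1 hw
  have hpv : p v ∈ J • (⊤ : Submodule A M) :=
    hmap J ▸ Submodule.mem_map_of_mem (Submodule.smul_mono le_rfl le_top hv)
  have hpxu : x • p u = -p v := by
    rw [eq_neg_iff_add_eq_zero, add_comm, ← map_smul, ← map_add]
    exact (congrArg p hvu).trans (hιp.apply_apply_eq_zero w)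
  have hpu : p u ∈ J • (⊤ : Submodule A M) :=
    hM _ (hmap (maximalIdeal A) ▸ Submodule.mem_map_of_mem hu) (hpxu ▸ neg_mem hpv)
  obtain ⟨t, ht, htu⟩ := (hmap J).ge hpu
  obtain ⟨w', hw'⟩ := (hιp (u - t)).1 (by rw [map_sub, htu, sub_self])
  have hsub : ι (w - x • w') = v + x • t := by
    rw [map_sub, map_smul, hw', ← hvu]
    change v + x • u - x • (u - t) = v + x • t
    module
  refine ⟨w', hsub ▸ add_mem hv ?_⟩
  rw [smul_comm J]
  exact Submodule.smul_mem_smul hx ht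

theorem IsRegularOnMaximalIdealSMul.mem_smul_top (hM : IsRegularOnMaximalIdealSMul xs M)
    (hι : Function.Injective ι) (hιp : Function.Exact ι p) (hp : Function.Surjective p)
    (hxs : ∀ x ∈ xs, x ∈ maximalIdeal A) {j : ℕ} (hj : j ≤ xs.length) {w : K}
    (hw : ι w ∈ Ideal.ofList (xs.take j) • maximalIdeal A • (⊤ : Submodule A F)) :
    w ∈ Ideal.ofList (xs.take j) • (⊤ : Submodule A K) := by
  induction j generalizing w with
  | zero =>
    rw [List.take_zero, Ideal.ofList_nil, Submodule.bot_smul, Submodule.mem_bot] at hw ⊢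
    exact hι (hw.trans (map_zero ι).symm)
  | succ j ih =>
    rw [ofList_take_succ xs hj] at hw ⊢
    obtain ⟨w', hw'⟩ := exists_map_sub_smul_mem hιp hp (hxs _ (xs.getElem_mem hj)) (hM j hj) hw
    rw [Submodule.sup_smul, ← sub_add_cancel w (xs[j] • w')]
    exact Submodule.add_mem_sup (ih (by lia) hw')
      (Submodule.smul_mem_smul (Ideal.mem_span_singleton_self _) trivial)

theorem map_mem_sq_smul_top (hmin : LinearMap.range ι ≤ maximalIdeal A • (⊤ : Submodule A F))
    {w : K} (hw : w ∈ maximalIdeal A • (⊤ : Submodule A K)) :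
    ι w ∈ maximalIdeal A ^ 2 • (⊤ : Submodule A F) := by
  have h := Submodule.mem_map_of_mem (f := ι) hw
  rw [Submodule.map_smul'', Submodule.map_top] at h
  rw [sq, mul_smul]
  exact Submodule.smul_mono le_rfl hmin h

theorem IsRegularOnMaximalIdealSMul.syzygy [Module.Free A F]
    (hM : IsRegularOnMaximalIdealSMul xs M) (hι : Function.Injective ι)
    (hιp : Function.Exact ι p) (hp : Function.Surjective p)
    (hmin : LinearMap.range ι ≤ maximalIdeal A • (⊤ : Submodule A F))
    (hreg : RingTheory.Sequence.IsWeaklyRegular A xs) (hxs : IsMinimalReduction xs) :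
    IsRegularOnMaximalIdealSMul xs K := by
  intro j hj w hw hxw
  refine hM.mem_smul_top hι hιp hp hxs.mem hj.le ?_
  have hιw : ι w ∈ Ideal.ofList (xs.take j) • (⊤ : Submodule A F) := by
    have h := Submodule.mem_map_of_mem (f := ι) hxw
    rw [Submodule.map_smul'', map_smul] at h
    have hF : IsSMulRegular (F ⧸ (Ideal.ofList (xs.take j) • ⊤ : Submodule A F)) xs[j] :=
      (isWeaklyRegular_of_flat hreg).regular_mod_prev j hj
    exact (isSMulRegular_quotient_iff_mem_of_smul_mem _ _).1 hF _
      (Submodule.smul_mono le_rfl le_top h)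
  rw [← mul_smul]
  exact smul_top_inf_smul_top_le (hxs.take_inf_sq_le j) ⟨hιw, map_mem_sq_smul_top hmin hw⟩

theorem IsRegularOnMaximalIdealSMul.maximalIdeal_smul_le
    (hM : IsRegularOnMaximalIdealSMul xs M) (hι : Function.Injective ι)
    (hιp : Function.Exact ι p) (hp : Function.Surjective p)
    (hmin : LinearMap.range ι ≤ maximalIdeal A • (⊤ : Submodule A F))
    (hxs : IsMinimalReduction xs) :
    maximalIdeal A • (⊤ : Submodule A K) ≤ Ideal.ofList xs • ⊤ := by
  intro w hw
  rw [← xs.take_length]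
  refine hM.mem_smul_top hι hιp hp hxs.mem le_rfl ?_
  rw [xs.take_length, ← mul_smul]
  exact Submodule.smul_mono_left hxs.sq_le (map_mem_sq_smul_top hmin hw)

end Syzygies

section BaseChange

variable {R S : Type*} [CommRing R] [CommRing S] [Algebra R S]

theorem map_smul_top_eq_baseChange {M : Type*} [AddCommGroup M] [Module R M] (I : Ideal R) :
    I.map (algebraMap R S) • (⊤ : Submodule S (S ⊗[R] M)) =
      (I • (⊤ : Submodule R M)).baseChange S := by
  rw [Ideal.map, ← Submodule.baseChange_top, ← Submodule.span_univ, Submodule.baseChange_span,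
    Submodule.span_smul_span]
  nth_rw 2 [← Submodule.span_eq I]
  rw [Submodule.span_smul_span, Submodule.baseChange_span]
  refine congrArg _ (Set.image_image2_distrib fun a m => ?_).symm
  rw [TensorProduct.mk_apply, TensorProduct.mk_apply, TensorProduct.tmul_smul, algebraMap_smul]

theorem range_baseChange_le {K F : Type*} [AddCommGroup K] [Module R K] [AddCommGroup F]
    [Module R F] (f : K →ₗ[R] F) :
    LinearMap.range (f.baseChange S) ≤ (LinearMap.range f).baseChange S := by
  have h : f.baseChange S = (LinearMap.range f).subtype.baseChange S ∘ₗ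
      f.rangeRestrict.baseChange S := by
    rw [← LinearMap.baseChange_comp]
    rfl
  exact h ▸ LinearMap.range_comp_le_range _ _

theorem ideal_smul_top_le_of_iSup_range_eq_top {ι : Type*} {N : ι → Type*}
    [∀ i, AddCommGroup (N i)] [∀ i, Module S (N i)] {L : Type*} [AddCommGroup L] [Module S L]
    {f : ∀ i, N i →ₗ[S] L} (hf : ⨆ i, LinearMap.range (f i) = ⊤) {I J : Ideal S}
    (h : ∀ i, I • (⊤ : Submodule S (N i)) ≤ J • ⊤) : I • (⊤ : Submodule S L) ≤ J • ⊤ := by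
  simp only [← hf, Submodule.smul_iSup, LinearMap.range_eq_map, ← Submodule.map_smul'']
  exact iSup_mono fun i => Submodule.map_mono (h i)

theorem iSup_range_baseChange_eq_top {ι : Type*} {N : ι → Type*} [∀ i, AddCommGroup (N i)]
    [∀ i, Module R (N i)] {L : Type*} [AddCommGroup L] [Module R L] {f : ∀ i, N i →ₗ[R] L}
    (hf : ⨆ i, LinearMap.range (f i) = ⊤) :
    ⨆ i, LinearMap.range ((f i).baseChange S) = ⊤ := by
  have hle : (⨆ i, LinearMap.range (f i)).map (TensorProduct.mk R S L 1) ≤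
      (⨆ i, LinearMap.range ((f i).baseChange S)).restrictScalars R := by
    rw [Submodule.map_iSup]
    refine iSup_le fun i => ?_
    rintro _ ⟨_, ⟨w, rfl⟩, rfl⟩
    exact Submodule.mem_iSup_of_mem i ⟨1 ⊗ₜ w, rfl⟩
  rw [eq_top_iff, ← Submodule.baseChange_top, Submodule.baseChange_eq_span, ← hf]
  exact Submodule.span_le.2 hle

end BaseChange

section Resolution

variable {R : Type u} [CommRing R] [IsLocalRing R]

theorem MinimalFreeResolution.exists_syzygy_exact {M : Type u} [AddCommGroup M] [Module R M]
    (F : MinimalFreeResolution R M) (n : ℕ) :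
    ∃ (ι : F.syzygy (n + 1) →ₗ[R] (Fin (F.rank n) → R))
      (p : (Fin (F.rank n) → R) →ₗ[R] F.syzygy n),
      Function.Injective ι ∧ Function.Exact ι p ∧ Function.Surjective p ∧
        LinearMap.range ι ≤ maximalIdeal R • ⊤ := by
  have hmin := (Submodule.range_subtype _).trans_le (F.minimal n)
  refine ⟨(LinearMap.range (F.diff n)).subtype, ?_⟩
  cases n with
  | zero => exact ⟨F.aug.rangeRestrict, Submodule.injective_subtype _,
      F.exact_aug.linearMap_rangeRestrict, F.aug.surjective_rangeRestrict, hmin⟩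
  | succ n => exact ⟨(F.diff n).rangeRestrict, Submodule.injective_subtype _,
      (F.exact_diff n).linearMap_rangeRestrict, (F.diff n).surjective_rangeRestrict, hmin⟩

theorem MinimalFreeResolution.maximalIdeal_smul_syzygy_zero
    (F : MinimalFreeResolution R (ResidueField R)) :
    maximalIdeal R • (⊤ : Submodule R (F.syzygy 0)) = ⊥ := by
  refine eq_bot_iff.2 (Submodule.smul_le.2 fun a ha ⟨w, _⟩ _ =>
    Subtype.ext (show a • w = 0 from ?_))
  rw [Algebra.smul_def, ResidueField.algebraMap_eq, (residue_eq_zero_iff a).2 ha, zero_mul]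

variable {S : Type u} [CommRing S] [IsLocalRing S] [Algebra R S]

theorem isRegularOnMaximalIdealSMul_syzygy [Module.Flat R S]
    (hmap : (maximalIdeal R).map (algebraMap R S) = maximalIdeal S)
    (F : MinimalFreeResolution R (ResidueField R)) {xs : List S}
    (hreg : RingTheory.Sequence.IsWeaklyRegular S xs) (hxs : IsMinimalReduction xs) (n : ℕ) :
    IsRegularOnMaximalIdealSMul xs (S ⊗[R] F.syzygy n) ∧
      maximalIdeal S • (⊤ : Submodule S (S ⊗[R] F.syzygy n)) ≤ Ideal.ofList xs • ⊤ := by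
  induction n with
  | zero =>
    have hbot : maximalIdeal S • (⊤ : Submodule S (S ⊗[R] F.syzygy 0)) = ⊥ := by
      rw [← hmap, map_smul_top_eq_baseChange, F.maximalIdeal_smul_syzygy_zero,
        Submodule.baseChange_bot]
    exact ⟨isRegularOnMaximalIdealSMul_of_smul_eq_bot xs hbot, hbot.trans_le bot_le⟩
  | succ n ih =>
    obtain ⟨ι, p, hι, hιp, hp, hmin⟩ := F.exists_syzygy_exact n
    have hι' : Function.Injective (ι.baseChange S) :=
      Module.Flat.lTensor_preserves_injective_linearMap ι hι
    have hιp' : Function.Exact (ι.baseChange S) (p.baseChange S) := lTensor_exact S hιp hp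
    have hp' : Function.Surjective (p.baseChange S) := LinearMap.lTensor_surjective S hp
    have hmin' : LinearMap.range (ι.baseChange S) ≤
        maximalIdeal S • (⊤ : Submodule S (S ⊗[R] (Fin (F.rank n) → R))) := by
      rw [← hmap, map_smul_top_eq_baseChange]
      exact (range_baseChange_le ι).trans (Submodule.baseChange_mono S hmin)
    exact ⟨ih.1.syzygy hι' hιp' hp' hmin' hreg hxs,
      ih.1.maximalIdeal_smul_le hι' hιp' hp' hmin' hxs⟩

theorem maximalIdeal_smul_baseChange_le_of_directSum_syzygy [Module.Flat R S]
    (hmap : (maximalIdeal R).map (algebraMap R S) = maximalIdeal S)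
    (F : MinimalFreeResolution R (ResidueField R)) {xs : List S}
    (hreg : RingTheory.Sequence.IsWeaklyRegular S xs) (hxs : IsMinimalReduction xs)
    {L : Type*} [AddCommGroup L] [Module R L] {ι : Type*} {ν : ι → ℕ}
    {f : DirectSum ι (fun j => (F.syzygy (ν j) : Type u)) →ₗ[R] L} (hf : Function.Surjective f) :
    maximalIdeal S • (⊤ : Submodule S (S ⊗[R] L)) ≤ Ideal.ofList xs • ⊤ := by
  classical
  have htop : ⨆ j, LinearMap.range (f ∘ₗ DirectSum.lof R ι _ j) = ⊤ := by
    simp only [LinearMap.range_comp]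
    rw [← Submodule.map_iSup]
    exact (congrArg _ DFinsupp.iSup_range_lsingle).trans
      (Submodule.map_top f |>.trans (LinearMap.range_eq_top.2 hf))
  exact ideal_smul_top_le_of_iSup_range_eq_top (iSup_range_baseChange_eq_top htop) fun j =>
    (isRegularOnMaximalIdealSMul_syzygy hmap F hreg hxs (ν j)).2

end Resolution

/-! ### Passage to an infinite residue field -/

section InfiniteResidueField

open Polynomial in
theorem exists_faithfullyFlat_infinite_residueField (R : Type u) [CommRing R] [IsLocalRing R]
    [IsNoetherianRing R] :
    ∃ (S : Type u) (_ : CommRing S) (_ : IsLocalRing S) (_ : Algebra R S),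
      IsNoetherianRing S ∧ Module.FaithfullyFlat R S ∧
      (maximalIdeal R).map (algebraMap R S) = maximalIdeal S ∧ Infinite (ResidueField S) ∧
      ringKrullDim S = ringKrullDim R := by
  let q : Ideal R[X] := (maximalIdeal R).map C
  have hq : q.IsPrime := Ideal.isPrime_map_C_of_isPrime
  let S := Localization.AtPrime q
  have hmap : (maximalIdeal R).map (algebraMap R S) = maximalIdeal S := by
    rw [IsScalarTower.algebraMap_eq R R[X] S, ← Ideal.map_map]
    exact Localization.AtPrime.map_eq_maximalIdeal
  have hloc : IsLocalHom (algebraMap R S) :=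
    ((local_hom_TFAE (algebraMap R S)).out 0 2 rfl rfl).mpr hmap.le
  have hflat : Module.Flat R S := Module.Flat.trans R R[X] S
  have hinj : Function.Injective fun n : ℕ => residue S (algebraMap R[X] S (X ^ n)) := by
    intro a b hab
    simp only at hab
    rw [← sub_eq_zero, ← map_sub, ← map_sub, residue_eq_zero_iff,
      ← Ideal.mem_comap, ← Ideal.under_def, IsLocalization.AtPrime.under_maximalIdeal S q,
      Ideal.mem_map_C_iff] at hab
    by_contra hne
    have hone := hab a
    rw [coeff_sub, coeff_X_pow_self, coeff_X_pow, if_neg hne, sub_zero] at hone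
    exact (Ideal.ne_top_iff_one _).mp (maximalIdeal.isMaximal R).ne_top hone
  have hdim : ringKrullDim S = ringKrullDim R := by
    rw [← maximalIdeal_height_eq_ringKrullDim, ← maximalIdeal_height_eq_ringKrullDim,
      ← IsLocalization.height_under q.primeCompl, IsLocalization.AtPrime.under_maximalIdeal _ q,
      height_map_C]
  exact ⟨S, inferInstance, inferInstance, inferInstance,
    IsLocalization.isNoetherianRing q.primeCompl _ inferInstance,
    Module.FaithfullyFlat.of_flat_of_isLocalHom, hmap, Infinite.of_injective _ hinj, hdim⟩

variable {R : Type u} [CommRing R] [IsLocalRing R] {S : Type u} [CommRing S] [IsLocalRing S]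
  [Algebra R S]

theorem nonempty_baseChange_residueField
    (hmap : (maximalIdeal R).map (algebraMap R S) = maximalIdeal S) :
    Nonempty (S ⊗[R] ResidueField R ≃ₗ[S] ResidueField S) :=
  ⟨(Algebra.TensorProduct.quotIdealMapEquivTensorQuot S (maximalIdeal R)).toLinearEquiv.symm ≪≫ₗ
    Submodule.quotEquivOfEq _ _ hmap⟩

variable [Module.FaithfullyFlat R S]

theorem length_quotient_maximalIdeal_pow_eq
    (hmap : (maximalIdeal R).map (algebraMap R S) = maximalIdeal S) (n : ℕ) :
    Module.length S (S ⧸ maximalIdeal S ^ n) = Module.length R (R ⧸ maximalIdeal R ^ n) := by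
  have : IsLocalHom (algebraMap R S) :=
    ((local_hom_TFAE (algebraMap R S)).out 0 2 rfl rfl).mpr hmap.le
  have hk : Module.length S (S ⧸ maximalIdeal S) = 1 := length_residueField
  rw [← hmap, ← Ideal.map_pow,
    (Algebra.TensorProduct.quotIdealMapEquivTensorQuot S
      (maximalIdeal R ^ n)).toLinearEquiv.length_eq,
    IsLocalRing.length_baseChange, hmap, hk, mul_one]

theorem HasMinimalMultiplicity.of_faithfullyFlat [IsNoetherianRing R] [IsNoetherianRing S]
    (h : HasMinimalMultiplicity R)
    (hmap : (maximalIdeal R).map (algebraMap R S) = maximalIdeal S)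
    (hdim : ringKrullDim S = ringKrullDim R) : HasMinimalMultiplicity S := by
  obtain ⟨e, d, ⟨P, hP, he⟩, hd, hed⟩ := h
  have hgen : (maximalIdeal S).spanFinrank = (maximalIdeal R).spanFinrank := by
    have hlen := length_quotient_maximalIdeal_pow_eq hmap 2
    rw [length_quotient_maximalIdeal_sq, length_quotient_maximalIdeal_sq] at hlen
    exact add_left_cancel (a := 1) (by exact_mod_cast hlen)
  refine ⟨e, d, ⟨P, ?_, he⟩, hdim.trans hd, hgen ▸ hed⟩
  filter_upwards [hP] with n hn
  rw [length_quotient_maximalIdeal_pow_eq hmap, hn]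

end InfiniteResidueField

/-! ### Vanishing over rings of minimal multiplicity -/

section Descent

variable {R : Type u} [CommRing R] [IsLocalRing R] [IsNoetherianRing R] {N : Type u}
  [AddCommGroup N] [Module R N]

theorem extVanishes_iff_of_maximalIdeal_le_annihilator {M : Type u} [AddCommGroup M] [Module R M]
    [Module.Finite R M] [Nontrivial M] (h : maximalIdeal R ≤ Module.annihilator R M) {i : ℕ} :
    ExtVanishes R M N i ↔ ExtVanishes R (ResidueField R) N i := by
  refine ⟨fun hM => ?_, fun hk => hk.of_isFiniteLength
    (isFiniteLength_of_pow_le_annihilator (n := 1) ((pow_one _).le.trans h))⟩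
  obtain ⟨f, g, hgf⟩ := exists_residueField_retract h
  exact hM.of_retract f g hgf

theorem ExtVanishes.residueField_of_maximalIdeal_smul_le {xs : List R} {L : Type u}
    [AddCommGroup L] [Module R L] [Module.Finite R L] (hL : RingTheory.Sequence.IsRegular L xs)
    (hle : maximalIdeal R • (⊤ : Submodule R L) ≤ Ideal.ofList xs • ⊤) (s : ℕ)
    (h : ∀ i, s ≤ i → i ≤ s + xs.length → ExtVanishes R L N i) :
    ExtVanishes R (ResidueField R) N (s + xs.length) := by
  have : Nontrivial (L ⧸ (Ideal.ofList xs • ⊤ : Submodule R L)) :=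
    Submodule.Quotient.nontrivial_iff.mpr hL.top_ne_smul.symm
  refine (extVanishes_iff_of_maximalIdeal_le_annihilator ?_).1
    (.quotient_ofList hL.toIsWeaklyRegular s h)
  rw [Submodule.annihilator_quotient]
  exact fun a ha => Submodule.mem_colon.2 fun v _ => hle (Submodule.smul_mem_smul ha trivial)

theorem ExtVanishes.residueField_of_sq_le {I : Ideal R} (hI : I ≤ maximalIdeal R)
    (hsq : maximalIdeal R ^ 2 ≤ I) {d : ℕ} (hRI : ∀ i, d < i → ExtVanishes R (R ⧸ I) N i)
    {j : ℕ} (hdj : d < j) (hj : ExtVanishes R (ResidueField R) N j) (i : ℕ) (hi : d < i) :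
    ExtVanishes R (ResidueField R) N i := by
  let g : (R ⧸ I) →ₗ[R] ResidueField R := Submodule.factor hI
  have hg : Function.Surjective g := Submodule.factor_surjective hI
  let K := LinearMap.ker g
  have hinj := K.injective_subtype
  have hexact : Function.Exact K.subtype g := LinearMap.exact_subtype_ker_map g
  rcases subsingleton_or_nontrivial K with hK | hK
  · exact (hRI i hi).of_linearEquiv (LinearEquiv.ofBijective g
      ⟨LinearMap.ker_eq_bot.mp ((Submodule.subsingleton_iff_eq_bot).mp hK), hg⟩).symm
  have hann : maximalIdeal R ≤ Module.annihilator R K := fun a ha =>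
    Module.mem_annihilator.2 fun ⟨z, hz⟩ => by
      obtain ⟨z, rfl⟩ := Submodule.mkQ_surjective _ z
      have hz' : z ∈ maximalIdeal R := (Submodule.Quotient.mk_eq_zero _).mp hz
      exact Subtype.ext ((Submodule.Quotient.mk_eq_zero _).mpr
        (hsq (sq (maximalIdeal R) ▸ Ideal.mul_mem_mul ha hz')))
  have hstep (t : ℕ) (ht : d < t) :
      ExtVanishes R (ResidueField R) N t ↔ ExtVanishes R (ResidueField R) N (t + 1) := by
    rw [← extVanishes_iff_of_maximalIdeal_le_annihilator hann (i := t)]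
    exact ⟨fun h => .right hinj hexact hg h (hRI _ (by omega)), .left hinj hexact hg (hRI t ht)⟩
  have hshift (t : ℕ) (ht : d < t) :
      ExtVanishes R (ResidueField R) N (d + 1) ↔ ExtVanishes R (ResidueField R) N t := by
    induction t, ht using Nat.le_induction with
    | base => rfl
    | succ t ht ih => exact ih.trans (hstep t ht)
  exact (hshift i hi).1 ((hshift j hdj).2 hj)

theorem IsMinimalReduction.extVanishes_residueField {xs : List R} (hxs : IsMinimalReduction xs)
    (hR : RingTheory.Sequence.IsWeaklyRegular R xs) {L : Type u} [AddCommGroup L] [Module R L]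
    [Module.Finite R L] (hL : RingTheory.Sequence.IsRegular L xs)
    (hle : maximalIdeal R • (⊤ : Submodule R L) ≤ Ideal.ofList xs • ⊤) {s : ℕ} (hs : 1 ≤ s)
    (h : ∀ i, s ≤ i → i ≤ s + xs.length → ExtVanishes R L N i) (i : ℕ) (hi : xs.length < i) :
    ExtVanishes R (ResidueField R) N i := by
  have hquot (j : ℕ) (hj : xs.length < j) : ExtVanishes R (R ⧸ Ideal.ofList xs) N j := by
    have := extVanishes_quotient_ofList_of_projective (N := N) hR j hj
    rwa [smul_eq_mul, Ideal.mul_top] at this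
  exact .residueField_of_sq_le (Ideal.span_le.mpr hxs.mem) (hxs.sq_le.trans Ideal.mul_le_left)
    hquot (by omega) (.residueField_of_maximalIdeal_smul_le hL hle s h) i hi

end Descent

section Main

variable {R : Type u} [CommRing R] [IsLocalRing R]

theorem IsCohenMacaulay.le_depth (hR : IsCohenMacaulay R) {d : ℕ} (hd : ringKrullDim R = d) :
    (d : ℕ∞) ≤ depth R R := by
  exact_mod_cast (hR.trans hd).ge

theorem IsMaximalCohenMacaulay.le_depth {L : Type u} [AddCommGroup L] [Module R L]
    (hL : IsMaximalCohenMacaulay R L) {d : ℕ} (hd : ringKrullDim R = d) :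
    (d : ℕ∞) ≤ depth R L := by
  exact_mod_cast (hL.depth_eq.trans hd).ge

theorem hasInjectiveDimensionLE_of_directSum_syzygy [IsNoetherianRing R] {d : ℕ}
    (hd : ringKrullDim R = d) (hR : (d : ℕ∞) ≤ depth R R) (hmult : HasMinimalMultiplicity R)
    (F : MinimalFreeResolution R (ResidueField R)) {L : Type u} [AddCommGroup L] [Module R L]
    [Module.Finite R L] [Nontrivial L] (hL : (d : ℕ∞) ≤ depth R L) {ι : Type*}
    {ν : ι → ℕ} {f : DirectSum ι (fun j => (F.syzygy (ν j) : Type u)) →ₗ[R] L}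
    (hf : Function.Surjective f) {N : Type u} [AddCommGroup N] [Module R N] [Module.Finite R N]
    {s : ℕ} (hs : 1 ≤ s) (h : ∀ i, s ≤ i → i ≤ s + d → ExtVanishes R L N i) :
    HasInjectiveDimensionLE (ModuleCat.of R N) d := by
  obtain ⟨S, _, _, _, _, _, hmap, _, hdim⟩ := exists_faithfullyFlat_infinite_residueField R
  obtain ⟨xs, rfl, hxS, hxL, hxs⟩ := (hmult.of_faithfullyFlat hmap hdim).exists_isMinimalReduction
    (hdim.trans hd) (hR.trans (depth_le_depth_of_isBaseChange hmap.le (IsBaseChange.linearMap R S)))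
    (S ⊗[R] L)
    (hL.trans (depth_le_depth_of_isBaseChange hmap.le (TensorProduct.isBaseChange R L S)))
  have hle : maximalIdeal S • (⊤ : Submodule S (S ⊗[R] L)) ≤ Ideal.ofList xs • ⊤ :=
    maximalIdeal_smul_baseChange_le_of_directSum_syzygy hmap F hxS.toIsWeaklyRegular hxs hf
  have hExt (i : ℕ) (hi : s ≤ i) (hi' : i ≤ s + xs.length) :
      ExtVanishes S (S ⊗[R] L) (S ⊗[R] N) i := by
    obtain ⟨i, rfl⟩ := Nat.exists_eq_add_of_le' (hs.trans hi)
    exact (extVanishes_baseChange_iff L i).2 (h _ hi hi')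
  refine hasInjectiveDimensionLE_of_extVanishes_residueField fun i hi => ?_
  obtain ⟨i, rfl⟩ := Nat.exists_eq_add_of_le' (show 1 ≤ i by omega)
  obtain ⟨e⟩ := nonempty_baseChange_residueField hmap
  rw [← extVanishes_baseChange_iff (S := S)]
  exact (hxs.extVanishes_residueField hxS.toIsWeaklyRegular hxL hle hs hExt _ hi).of_linearEquiv e

theorem theorem5p1_general [IsNoetherianRing R] {d : ℕ} (hd : ringKrullDim R = d)
    (hCM : IsCohenMacaulay R) (hmult : HasMinimalMultiplicity R)
    (F : MinimalFreeResolution R (ResidueField R)) {L : Type u} [AddCommGroup L] [Module R L]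
    [Nontrivial L] (hL : IsMaximalCohenMacaulay R L) {ι : Type*} {ν : ι → ℕ}
    {f : DirectSum ι (fun j => (F.syzygy (ν j) : Type u)) →ₗ[R] L} (hf : Function.Surjective f)
    (N : Type u) [AddCommGroup N] [Module R N] [Module.Finite R N] :
    List.TFAE
      [∃ s : ℕ, 1 ≤ s ∧ ∀ i : ℕ, s ≤ i → i ≤ s + d →
          Subsingleton (Ext (ModuleCat.of R L) (ModuleCat.of R N) i),
        ∀ i : ℕ, 1 ≤ i → Subsingleton (Ext (ModuleCat.of R L) (ModuleCat.of R N) i),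
        ∃ n : ℕ, HasInjectiveDimensionLE (ModuleCat.of R N) n] := by
  have := hL.finite
  tfae_have 1 → 3 := fun ⟨_, hs, h⟩ => ⟨d, hasInjectiveDimensionLE_of_directSum_syzygy hd
    (hCM.le_depth hd) hmult F (hL.le_depth hd) hf hs h⟩
  tfae_have 3 → 2 := fun ⟨_, hN⟩ =>
    extVanishes_of_le_depth hd.le (hCM.le_depth hd) (hL.le_depth hd) hN
  tfae_have 2 → 1 := fun h => ⟨1, le_rfl, fun i hi _ => h i hi⟩
  tfae_finish

end Main

end LocalAlgebra

theorem theorem5p1 (R : Type u) [CommRing R] [IsLocalRing R] [IsNoetherianRing R]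
    (d : ℕ) (hd : ringKrullDim R = d)
    (hCM : LocalAlgebra.IsCohenMacaulay R)
    (hmult : LocalAlgebra.HasMinimalMultiplicity R)
    (F : LocalAlgebra.MinimalFreeResolution R (IsLocalRing.ResidueField R))
    (L : Type u) [AddCommGroup L] [Module R L] [Nontrivial L]
    (hL : LocalAlgebra.IsMaximalCohenMacaulay R L)
    (r : ℕ) (ν : Fin r → ℕ)
    (f : DirectSum (Fin r) (fun j => (F.syzygy (ν j) : Type u)) →ₗ[R] L)
    (hf : Function.Surjective f) :
    List.TFAE
      [∃ s : ℕ, 1 ≤ s ∧ ∀ i : ℕ, s ≤ i → i ≤ s + d →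
          Subsingleton (CategoryTheory.Abelian.Ext (ModuleCat.of R L) (ModuleCat.of R R) i),
        ∀ i : ℕ, 1 ≤ i →
          Subsingleton (CategoryTheory.Abelian.Ext (ModuleCat.of R L) (ModuleCat.of R R) i),
        LocalAlgebra.IsGorenstein R] :=
  LocalAlgebra.theorem5p1_general hd hCM hmult F hL hf R
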